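/- Let $n \ge 2$ and let $X \subset \mathbb{C}^n$ be a closed algebraic subset (the common zero set of some polynomials, possibly reducible, singular or empty) of codimension at least $2$, that is, $\dim X \le n-2$, where $\dim X$ is the maximal dimension of an irreducible component. Let $I \subset \mathbb{C}[x_1,\dots,x_n]$ be the ideal of all polynomials vanishing on $X$, and suppose that for every $x \in X$ the Zariski tangent space $$T_xX = \{ v \in \mathbb{C}^n : df_x(v) = 0 \text{ for all } f \in I \}$$ has dimension at most $n-1$. An algebraic vector field on $\mathbb{C}^n$ is a field $V=\sum_i f_i\,\partial/\partial x_i$ with polynomial coordinate functions $f_i$; it is called completely integrable if for every $z\in\mathbb{C}^n$ there is a holomorphic curve $\gamma:\mathbb{C}\to\mathbb{C}^n$ with $\gamma(0)=z$ and $\gamma'(t)=V(\gamma(t))$ for all $t\in\mathbb{C}$. Then the complex Lie algebra $\operatorname{Lie}_{alg}(\mathbb{C}^n,X)$ generated by all completely integrable algebraic vector fields on $\mathbb{C}^n$ that vanish at every point of $X$ is equal to the Lie algebra $\operatorname{AVF}_I(\mathbb{C}^n)$ of all algebraic vector fields on $\mathbb{C}^n$ whose coordinate functions lie in $I$, i.e.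 of all algebraic vector fields vanishing on $X$. -/

import Mathlib

open MvPolynomial

noncomputable section

namespace AlgebraicDensity

/-- Algebraic vector fields on `ℂⁿ`, as derivations of the polynomial ring. The vector field with
coordinate functions `V (X i)` is `∑ i, V (X i) ∂/∂xᵢ`, and the bracket is the commutator. -/
abbrev VF (n : ℕ) : Type :=
  Derivation ℂ (MvPolynomial (Fin n) ℂ) (MvPolynomial (Fin n) ℂ)

/-- The tangent vector `V(z) ∈ ℂⁿ` of an algebraic vector field at the point `z`. -/
def VF.value {n : ℕ} (V : VF n) (z : Fin n → ℂ) : Fin n → ℂ :=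
  fun i => eval z (V (X i))

/-- `V` is completely integrable: through every point there passes a holomorphic integral curve
which is defined for all complex times. -/
def VF.CompletelyIntegrable {n : ℕ} (V : VF n) : Prop :=
  ∀ z : Fin n → ℂ, ∃ γ : ℂ → (Fin n → ℂ), γ 0 = z ∧ ∀ t : ℂ, HasDerivAt γ (V.value (γ t)) t

/-- `V` vanishes at every point of `Y`. -/
def VF.VanishesOn {n : ℕ} (V : VF n) (Y : Set (Fin n → ℂ)) : Prop :=
  ∀ z ∈ Y, V.value z = 0

/-- The complex Lie algebra generated by the completely integrable algebraic vector fields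
on `ℂⁿ` that vanish on `Y`. -/
def lieAlg {n : ℕ} (Y : Set (Fin n → ℂ)) : LieSubalgebra ℂ (VF n) :=
  LieSubalgebra.lieSpan ℂ (VF n) {V | V.CompletelyIntegrable ∧ V.VanishesOn Y}

theorem apply_mem_of_forall_X {n : ℕ} {L : Ideal (MvPolynomial (Fin n) ℂ)} {V : VF n}
    (h : ∀ i, V (X i) ∈ L) (f : MvPolynomial (Fin n) ℂ) : V f ∈ L := by
  induction f using MvPolynomial.induction_on with
  | C a => simp
  | add p q hp hq => rw [map_add]; exact L.add_mem hp hq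
  | mul_X p i hp =>
    rw [Derivation.leibniz, smul_eq_mul, smul_eq_mul]
    exact L.add_mem (L.mul_mem_left _ (h i)) (L.mul_mem_left _ hp)

/-- The Lie algebra of the algebraic vector fields whose coordinate functions lie in `L`. -/
def AVF {n : ℕ} (L : Ideal (MvPolynomial (Fin n) ℂ)) : LieSubalgebra ℂ (VF n) where
  carrier := {V | ∀ i, V (X i) ∈ L}
  zero_mem' := fun i => by simp
  add_mem' := fun {V W} hV hW i => by
    rw [Derivation.add_apply]; exact L.add_mem (hV i) (hW i)
  smul_mem' := fun c V hV i => by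
    rw [Derivation.smul_apply, MvPolynomial.smul_eq_C_mul]; exact L.mul_mem_left _ (hV i)
  lie_mem' := fun {V W} hV hW i => by
    rw [Derivation.commutator_apply]
    exact L.sub_mem (apply_mem_of_forall_X hV _) (apply_mem_of_forall_X hW _)

/-- Closed algebraic subsets of `ℂⁿ`. -/
def IsClosedAlgebraic {n : ℕ} (Y : Set (Fin n → ℂ)) : Prop :=
  ∃ J : Ideal (MvPolynomial (Fin n) ℂ), Y = zeroLocus ℂ J

/-- The defining ideal of `Y`: all polynomials vanishing on `Y`. -/
abbrev definingIdeal {n : ℕ} (Y : Set (Fin n → ℂ)) : Ideal (MvPolynomial (Fin n) ℂ) :=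
  vanishingIdeal ℂ Y

/-- The dimension of an algebraic set, i.e. the Krull dimension of its coordinate ring
(the maximal dimension of a component; `⊥` for the empty set). -/
def algDim {n : ℕ} (Y : Set (Fin n → ℂ)) : WithBot ℕ∞ :=
  ringKrullDim (MvPolynomial (Fin n) ℂ ⧸ definingIdeal Y)

/-- The differential `df_z : ℂⁿ → ℂ`, `v ↦ ∑ i, ∂f/∂xᵢ(z) vᵢ`, of a polynomial. -/
def differential {n : ℕ} (f : MvPolynomial (Fin n) ℂ) (z : Fin n → ℂ) :
    (Fin n → ℂ) →ₗ[ℂ] ℂ :=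
  ∑ i, eval z (pderiv i f) • LinearMap.proj i

/-- The Zariski tangent space of `Y` at `z`, as a subspace of `ℂⁿ`: the common kernel of the
differentials at `z` of all elements of the defining ideal. -/
def zariskiTangentSpace {n : ℕ} (Y : Set (Fin n → ℂ)) (z : Fin n → ℂ) :
    Submodule ℂ (Fin n → ℂ) :=
  ⨅ f ∈ definingIdeal Y, LinearMap.ker (differential f z)

end AlgebraicDensity

end

open MvPolynomial

noncomputable section

namespace AlgebraicDensity

/-! Write I for the ideal of X. A field `q • dirDeriv v` with q in I affine along v is completely
integrable; brackets of such fields, and of certain triangular ones, supply the rest. Call q a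
multiplier for an ideal K if q h V lies in the Lie algebra for all h in K and all fields V.
Multipliers form an ideal, so by the Nullstellensatz it suffices to find, at every point, a
multiplier for I not vanishing there, and only generic constant directions V = ∂_v need be treated
(`exists_mem_multiplierIdeal`).

Off X, codimension two lets generic projections along v and u separate the point from X. This gives
p, g in I, nonzero at the point and constant along u and v respectively, and `lie_sub_lie_smul` then
yields p g h ∂_v for every h. Hence the multipliers for the unit ideal vanish only on X, and they
contain some I^N.

At x in X, proper tangent spaces make a generic projection along v an embedding over a neighbourhood
of the image of x, and generically on each component. So X is locally a graph: F = sζ - r lies in I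
with s, r constant along v and s(x) ≠ 0 (`exists_graph_of_generic`). The conductor of the projection
is small enough that s can also be taken constant along a second direction u, so s∂_u + (∂_u r)∂_v
kills F. Modulo I^(N+1), a power of s times h in I is a polynomial in F with coefficients constant
along v. Its terms of degree at most one give completely integrable multiples of ∂_v, the higher
ones come from triangular brackets, and I^N absorbs the remainder. -/

variable {n : ℕ}

/-! ### Constant fields and restriction of polynomials to lines. -/

/-- The constant vector field `v`, i.e. the directional derivative along `v`. -/
def dirDeriv (v : Fin n → ℂ) : VF n :=
  mkDerivation ℂ fun i => C (v i)

@[simp]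
theorem dirDeriv_X (v : Fin n → ℂ) (i : Fin n) : dirDeriv v (X i) = C (v i) := by
  simp [dirDeriv]

theorem dirDeriv_add (u v : Fin n → ℂ) : dirDeriv (u + v) = dirDeriv u + dirDeriv v := by
  ext i; simp

theorem dirDeriv_smul (c : ℂ) (v : Fin n → ℂ) : dirDeriv (c • v) = c • dirDeriv v := by
  refine MvPolynomial.derivation_ext fun i => ?_
  simp [MvPolynomial.smul_eq_C_mul]

theorem dirDeriv_zero : dirDeriv (0 : Fin n → ℂ) = 0 := by
  refine MvPolynomial.derivation_ext fun i => ?_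
  simp

theorem lie_dirDeriv (u v : Fin n → ℂ) : ⁅dirDeriv u, dirDeriv v⁆ = 0 := by
  refine MvPolynomial.derivation_ext fun i => ?_
  simp [Derivation.commutator_apply]

theorem dirDeriv_comm (u v : Fin n → ℂ) (f : MvPolynomial (Fin n) ℂ) :
    dirDeriv u (dirDeriv v f) = dirDeriv v (dirDeriv u f) := by
  have h := DFunLike.congr_fun (lie_dirDeriv u v) f
  rwa [Derivation.commutator_apply, Derivation.zero_apply, sub_eq_zero] at h

/-- Restriction of polynomials to the parametrized line `t ↦ w + t v`. -/
def lineEval (w v : Fin n → ℂ) : MvPolynomial (Fin n) ℂ →ₐ[ℂ] Polynomial ℂ :=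
  aeval fun i => Polynomial.C (w i) + Polynomial.C (v i) * Polynomial.X

theorem eval_lineEval (w v : Fin n → ℂ) (t : ℂ) (f : MvPolynomial (Fin n) ℂ) :
    (lineEval w v f).eval t = eval (w + t • v) f := by
  induction f using MvPolynomial.induction_on with
  | C a => simp [lineEval, ← MvPolynomial.algebraMap_eq]
  | add p q hp hq => simp [hp, hq]
  | mul_X p i hp =>
    rw [map_mul, Polynomial.eval_mul, hp, map_mul]
    simp [lineEval]
    exact Or.inl (mul_comm _ _)

theorem derivative_lineEval (w v : Fin n → ℂ) (f : MvPolynomial (Fin n) ℂ) :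
    Polynomial.derivative (lineEval w v f) = lineEval w v (dirDeriv v f) := by
  induction f using MvPolynomial.induction_on with
  | C a => simp [lineEval, ← MvPolynomial.algebraMap_eq, Polynomial.algebraMap_eq]
  | add p q hp hq => simp [hp, hq]
  | mul_X p i hp =>
    rw [map_mul, Polynomial.derivative_mul, hp, Derivation.leibniz]
    simp [lineEval, ← MvPolynomial.algebraMap_eq, Polynomial.algebraMap_eq]
    ring

theorem lineEval_eq_C {v : Fin n → ℂ} {f : MvPolynomial (Fin n) ℂ} (hf : dirDeriv v f = 0)
    (w : Fin n → ℂ) : lineEval w v f = Polynomial.C (eval w f) := by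
  have h : Polynomial.derivative (lineEval w v f) = 0 := by simp [derivative_lineEval, hf]
  have h1 := Polynomial.eq_C_of_derivative_eq_zero h
  have h2 := eval_lineEval w v 0 f
  rw [h1] at h2 ⊢
  simpa using h2

theorem eval_add_smul_of_const {v : Fin n → ℂ} {f : MvPolynomial (Fin n) ℂ}
    (hf : dirDeriv v f = 0) (w : Fin n → ℂ) (t : ℂ) : eval (w + t • v) f = eval w f := by
  rw [← eval_lineEval, lineEval_eq_C hf, Polynomial.eval_C]

theorem eval_add_smul_of_linear {v : Fin n → ℂ} {f : MvPolynomial (Fin n) ℂ}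
    (hf : dirDeriv v (dirDeriv v f) = 0) (w : Fin n → ℂ) (t : ℂ) :
    eval (w + t • v) f = eval w f + t * eval w (dirDeriv v f) := by
  have h : Polynomial.derivative
      (lineEval w v f - Polynomial.C (eval w (dirDeriv v f)) * Polynomial.X) = 0 := by
    simp [derivative_lineEval, lineEval_eq_C hf]
  have h1 := Polynomial.eq_C_of_derivative_eq_zero h
  have h0 := congrArg (Polynomial.eval 0) h1
  have ht := congrArg (Polynomial.eval t) h1
  simp only [Polynomial.eval_sub, eval_lineEval, Polynomial.eval_mul, Polynomial.eval_C,
    Polynomial.eval_X, mul_zero, sub_zero, zero_smul, add_zero] at h0 ht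
  rw [← h0] at ht
  linear_combination ht

/-! ### Completely integrable fields: shears and triangular fields. -/

theorem exists_linear_ode (α β : ℂ) :
    ∃ τ : ℂ → ℂ, τ 0 = 0 ∧ ∀ t, HasDerivAt τ (α + τ t * β) t := by
  by_cases hβ : β = 0
  · refine ⟨fun t => t * α, by simp, fun t => ?_⟩
    simpa [hβ] using (hasDerivAt_id t).mul_const α
  · refine ⟨fun t => (Complex.exp (t * β) - 1) * (α / β), by simp, fun t => ?_⟩
    have h := ((((hasDerivAt_id t).mul_const β).cexp).sub_const 1).mul_const (α / β)
    refine h.congr_deriv ?_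
    simp only [id]
    field_simp
    ring

/-- Orbits stay on lines parallel to v, where q is affine, so the flow reduces to a scalar linear
equation. -/
theorem completelyIntegrable_smul_dirDeriv {v : Fin n → ℂ} {q : MvPolynomial (Fin n) ℂ}
    (hq : dirDeriv v (dirDeriv v q) = 0) :
    VF.CompletelyIntegrable (q • dirDeriv v) := by
  intro z
  obtain ⟨τ, h0, hτ⟩ := exists_linear_ode (eval z q) (eval z (dirDeriv v q))
  refine ⟨fun t => z + τ t • v, by simp [h0], fun t => ?_⟩
  have h := ((hτ t).smul_const v).const_add z
  refine h.congr_deriv ?_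
  ext i
  simp [VF.value, eval_add_smul_of_linear hq]

/-- A triangular field which annihilates `s * ζ - r`, multiplied by a power of `s * ζ - r` and by
a function linear along `u`. -/
theorem completelyIntegrable_triangular {u v : Fin n → ℂ} {s r ζ l : MvPolynomial (Fin n) ℂ}
    (hsu : dirDeriv u s = 0) (hsv : dirDeriv v s = 0) (hrv : dirDeriv v r = 0)
    (hζu : dirDeriv u ζ = 0) (hζv : dirDeriv v ζ = 1) (hlv : dirDeriv v l = 0)
    (hlu : dirDeriv u (dirDeriv u l) = 0) (j : ℕ) :
    VF.CompletelyIntegrable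
      ((l * (s * ζ - r) ^ j) • (s • dirDeriv u + dirDeriv u r • dirDeriv v)) := by
  intro z
  have es (a b : ℂ) : eval (z + a • u + b • v) s = eval z s := by
    rw [eval_add_smul_of_const hsv, eval_add_smul_of_const hsu]
  have er (a b : ℂ) : eval (z + a • u + b • v) r = (lineEval z u r).eval a := by
    rw [eval_add_smul_of_const hrv, eval_lineEval]
  have er' (a b : ℂ) : eval (z + a • u + b • v) (dirDeriv u r) =
      (Polynomial.derivative (lineEval z u r)).eval a := by
    rw [eval_add_smul_of_const (by rw [dirDeriv_comm, hrv, map_zero]), derivative_lineEval,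
      eval_lineEval]
  have eζ (a b : ℂ) : eval (z + a • u + b • v) ζ = eval z ζ + b := by
    rw [eval_add_smul_of_linear (by simp [hζv]), eval_add_smul_of_const hζu, hζv]; simp
  have el (a b : ℂ) : eval (z + a • u + b • v) l = eval z l + a * eval z (dirDeriv u l) := by
    rw [eval_add_smul_of_const hlv, eval_add_smul_of_linear hlu]
  set R := lineEval z u r with hR
  have hR0 : R.eval 0 = eval z r := by rw [hR, eval_lineEval]; simp
  set s₀ := eval z s with hs₀
  set f₀ := s₀ * eval z ζ - eval z r with hf₀
  obtain ⟨a, ha0, ha⟩ := exists_linear_ode (f₀ ^ j * s₀ * eval z l)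
    (f₀ ^ j * s₀ * eval z (dirDeriv u l))
  have key : ∃ b : ℂ → ℂ, b 0 = 0 ∧ (∀ t, s₀ * b t = R.eval (a t) - R.eval 0) ∧
      ∀ t, HasDerivAt b (f₀ ^ j * (eval z l + a t * eval z (dirDeriv u l)) *
        (Polynomial.derivative R).eval (a t)) t := by
    -- Since s and sζ - r are constant along an orbit, s₀ b = R(a) - R(0). This determines b if s₀ ≠
    -- 0; otherwise a vanishes identically and b is linear in t.
    by_cases hs : s₀ = 0
    · have ha' (t : ℂ) : a t = 0 := by
        have : ∀ t, HasDerivAt a 0 t := fun t => by simpa [hs] using ha t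
        rw [← ha0]
        exact is_const_of_deriv_eq_zero (fun t => (this t).differentiableAt)
          (fun t => (this t).deriv) t 0
      refine ⟨fun t => t * (f₀ ^ j * eval z l * (Polynomial.derivative R).eval 0), by simp,
        fun t => by simp [ha', hs], fun t => ?_⟩
      simpa [ha'] using (hasDerivAt_id t).mul_const
        (f₀ ^ j * eval z l * (Polynomial.derivative R).eval 0)
    · refine ⟨fun t => (R.eval (a t) - R.eval 0) / s₀, by simp [ha0],
        fun t => by field_simp, fun t => ?_⟩
      have h := (((R.hasDerivAt (a t)).comp t (ha t)).sub_const (R.eval 0)).div_const s₀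
      refine h.congr_deriv ?_
      field_simp
  obtain ⟨b, hb0, hbR, hb⟩ := key
  refine ⟨fun t => z + a t • u + b t • v, by simp [ha0, hb0], fun t => ?_⟩
  have h := (((ha t).smul_const u).const_add z).add ((hb t).smul_const v)
  refine h.congr_deriv ?_
  have ef : s₀ * (eval z ζ + b t) - R.eval (a t) = f₀ := by
    linear_combination hbR t - hR0
  ext i
  simp only [VF.value, Derivation.smul_apply, Derivation.add_apply, dirDeriv_X, smul_eq_mul,
    map_mul, map_add, map_sub, map_pow, es, er, er', eζ, el, ef, eval_C, Pi.add_apply,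
    Pi.smul_apply]
  ring

/-! ### Fields obtained from brackets. -/

theorem VF.smul_mem_lieAlg {Y : Set (Fin n → ℂ)} {q : MvPolynomial (Fin n) ℂ} {V : VF n}
    (hq : q ∈ definingIdeal Y) (hV : VF.CompletelyIntegrable (q • V)) : q • V ∈ lieAlg Y := by
  refine LieSubalgebra.subset_lieSpan ⟨hV, fun z hz => ?_⟩
  ext i
  have : eval z q = 0 := by simpa [MvPolynomial.aeval_eq_eval] using hq z hz
  simp [VF.value, this]

theorem smul_dirDeriv_mem_lieAlg {Y : Set (Fin n → ℂ)} {q : MvPolynomial (Fin n) ℂ}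
    {v : Fin n → ℂ} (hq : q ∈ definingIdeal Y) (hqv : dirDeriv v (dirDeriv v q) = 0) :
    q • dirDeriv v ∈ lieAlg Y :=
  VF.smul_mem_lieAlg hq (completelyIntegrable_smul_dirDeriv hqv)

/-- Moving η from one field to the other cancels all terms with derivatives of F or g; only the term
with D η survives. This turns coefficients of two fields into their product. -/
theorem lie_sub_lie_smul (D E : VF n) (hDE : ⁅D, E⁆ = 0) (F g η : MvPolynomial (Fin n) ℂ)
    (hE : E η = 0) :
    ⁅(η * F) • D, g • E⁆ - ⁅F • D, (η * g) • E⁆ = -((F * g * D η) • E) := by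
  have comm (f : MvPolynomial (Fin n) ℂ) : D (E f) = E (D f) := by
    have h := DFunLike.congr_fun hDE f
    rwa [Derivation.commutator_apply, Derivation.zero_apply, sub_eq_zero] at h
  refine MvPolynomial.derivation_ext fun i => ?_
  simp only [Derivation.sub_apply, Derivation.commutator_apply, Derivation.smul_apply,
    Derivation.neg_apply, smul_eq_mul, Derivation.leibniz, comm, hE]
  ring

theorem lie_dirDeriv_triangular {u v : Fin n → ℂ} {s r : MvPolynomial (Fin n) ℂ}
    (hsv : dirDeriv v s = 0) (hrv : dirDeriv v r = 0) :
    ⁅s • dirDeriv u + dirDeriv u r • dirDeriv v, dirDeriv v⁆ = 0 := by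
  refine MvPolynomial.derivation_ext fun i => ?_
  simp [Derivation.commutator_apply, hsv, dirDeriv_comm v u, hrv]

theorem mul_smul_dirDeriv_mem_lieAlg {Y : Set (Fin n → ℂ)} {u v : Fin n → ℂ}
    {η p g : MvPolynomial (Fin n) ℂ} (hηu : dirDeriv u η = 1) (hηv : dirDeriv v η = 0)
    (hp : p ∈ definingIdeal Y) (hpu : dirDeriv u p = 0) (hg : g ∈ definingIdeal Y)
    (hgv : dirDeriv v g = 0) : (p * g) • dirDeriv v ∈ lieAlg Y := by
  have h1 : (η * p) • dirDeriv u ∈ lieAlg Y :=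
    smul_dirDeriv_mem_lieAlg (Ideal.mul_mem_left _ _ hp) (by simp [hηu, hpu])
  have h2 : g • dirDeriv v ∈ lieAlg Y := smul_dirDeriv_mem_lieAlg hg (by simp [hgv])
  have h3 : p • dirDeriv u ∈ lieAlg Y := smul_dirDeriv_mem_lieAlg hp (by simp [hpu])
  have h4 : (η * g) • dirDeriv v ∈ lieAlg Y :=
    smul_dirDeriv_mem_lieAlg (Ideal.mul_mem_left _ _ hg) (by simp [hηv, hgv])
  have h := (lieAlg Y).sub_mem ((lieAlg Y).lie_mem h1 h2) ((lieAlg Y).lie_mem h3 h4)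
  rw [lie_sub_lie_smul _ _ (lie_dirDeriv u v) _ _ _ hηv, hηu, mul_one] at h
  simpa using (lieAlg Y).neg_mem h

/-- The same bracket with the triangular field D in place of ∂_u: it commutes with ∂_v and satisfies
D η = s. -/
theorem pow_mul_smul_dirDeriv_mem_lieAlg {Y : Set (Fin n → ℂ)} {u v : Fin n → ℂ}
    {s r ζ η g : MvPolynomial (Fin n) ℂ}
    (hsu : dirDeriv u s = 0) (hsv : dirDeriv v s = 0) (hrv : dirDeriv v r = 0)
    (hζu : dirDeriv u ζ = 0) (hζv : dirDeriv v ζ = 1) (hηu : dirDeriv u η = 1)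
    (hηv : dirDeriv v η = 0) (hf : s * ζ - r ∈ definingIdeal Y) {j : ℕ} (hj : j ≠ 0)
    (hg : g ∈ definingIdeal Y) (hgv : dirDeriv v (dirDeriv v g) = 0) :
    (s * ((s * ζ - r) ^ j * g)) • dirDeriv v ∈ lieAlg Y := by
  set D : VF n := s • dirDeriv u + dirDeriv u r • dirDeriv v with hD
  have hfj : (s * ζ - r) ^ j ∈ definingIdeal Y := Ideal.pow_mem_of_mem _ hf j (by lia)
  have h1 : (η * (s * ζ - r) ^ j) • D ∈ lieAlg Y :=
    VF.smul_mem_lieAlg (Ideal.mul_mem_left _ _ hfj)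
      (completelyIntegrable_triangular hsu hsv hrv hζu hζv hηv (by simp [hηu]) j)
  have h2 : g • dirDeriv v ∈ lieAlg Y := smul_dirDeriv_mem_lieAlg hg hgv
  have h3 : (s * ζ - r) ^ j • D ∈ lieAlg Y := by
    have := completelyIntegrable_triangular (l := 1) hsu hsv hrv hζu hζv (by simp) (by simp) j
    rw [one_mul] at this
    exact VF.smul_mem_lieAlg hfj this
  have h4 : (η * g) • dirDeriv v ∈ lieAlg Y :=
    smul_dirDeriv_mem_lieAlg (Ideal.mul_mem_left _ _ hg) (by simp [hηv, hgv])
  have h := (lieAlg Y).sub_mem ((lieAlg Y).lie_mem h1 h2) ((lieAlg Y).lie_mem h3 h4)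
  have hDη : D η = s := by simp [hD, hηu, hηv]
  rw [lie_sub_lie_smul _ _ (lie_dirDeriv_triangular hsv hrv) _ _ _ hηv, hDη, mul_comm _ s] at h
  simpa using (lieAlg Y).neg_mem h

/-! ### Expansion along a direction and Noether normalization. -/

/-- The polynomials that are constant along `v`. -/
def constAlong (v : Fin n → ℂ) : Subalgebra ℂ (MvPolynomial (Fin n) ℂ) where
  carrier := {f | dirDeriv v f = 0}
  mul_mem' := fun {a b} ha hb => by
    simp only [Set.mem_ofPred_eq] at *
    simp [ha, hb]
  add_mem' := fun {a b} ha hb => by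
    simp only [Set.mem_ofPred_eq] at *
    simp [ha, hb]
  algebraMap_mem' := fun c => by simp

theorem mem_constAlong {v : Fin n → ℂ} {f : MvPolynomial (Fin n) ℂ} :
    f ∈ constAlong v ↔ dirDeriv v f = 0 := Iff.rfl

/-- The coordinate of `x - ζ(x) v`, a polynomial which is constant along `v`. -/
def transverseCoord {v : Fin n → ℂ} {ζ : MvPolynomial (Fin n) ℂ} (hζ : dirDeriv v ζ = 1)
    (i : Fin n) : constAlong v :=
  ⟨X i - C (v i) * ζ, by simp [mem_constAlong, hζ, ← MvPolynomial.algebraMap_eq]⟩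

/-- Expansion of a polynomial in powers of `ζ` with coefficients constant along `v`. -/
def expand {v : Fin n → ℂ} {ζ : MvPolynomial (Fin n) ℂ} (hζ : dirDeriv v ζ = 1) :
    MvPolynomial (Fin n) ℂ →ₐ[ℂ] Polynomial (constAlong v) :=
  aeval fun i => Polynomial.C (transverseCoord hζ i) +
    Polynomial.C (algebraMap ℂ (constAlong v) (v i)) * Polynomial.X

theorem aeval_expand {v : Fin n → ℂ} {ζ : MvPolynomial (Fin n) ℂ} (hζ : dirDeriv v ζ = 1)
    (f : MvPolynomial (Fin n) ℂ) : Polynomial.aeval ζ (expand hζ f) = f := by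
  have h : ((Polynomial.aeval ζ : Polynomial (constAlong v) →ₐ[constAlong v] _).restrictScalars
      ℂ).comp (expand hζ) = AlgHom.id ℂ _ := by
    refine MvPolynomial.algHom_ext fun i => ?_
    simp only [AlgHom.comp_apply, expand, aeval_X, AlgHom.restrictScalars_apply, map_add, map_mul,
      Polynomial.aeval_C, Polynomial.aeval_X, ← IsScalarTower.algebraMap_apply]
    simp [transverseCoord, MvPolynomial.algebraMap_eq]
  exact DFunLike.congr_fun h f

/-- Each variable becomes a constant plus `v i` times the new variable, so top coefficients multiply
to the value of the monomial at v. -/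
theorem expand_monomial {v : Fin n → ℂ} {ζ : MvPolynomial (Fin n) ℂ} (hζ : dirDeriv v ζ = 1)
    (d : Fin n →₀ ℕ) :
    (expand hζ (monomial d 1)).natDegree ≤ d.degree ∧
      (expand hζ (monomial d 1)).coeff d.degree =
        algebraMap ℂ (constAlong v) (eval v (monomial d 1)) := by
  induction d using Finsupp.induction_linear with
  | zero => simp [expand, ← MvPolynomial.C_apply]
  | add d e hd he =>
    have h1 : monomial (d + e) (1 : ℂ) = monomial d 1 * monomial e 1 := by simp
    rw [h1, map_mul, map_mul, map_mul, map_add]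
    refine ⟨Polynomial.natDegree_mul_le_of_le hd.1 he.1, ?_⟩
    rw [Polynomial.coeff_mul_add_eq_of_natDegree_le hd.1 he.1, hd.2, he.2]
  | single i k =>
    have h1 : monomial (Finsupp.single i k) (1 : ℂ) = X i ^ k := by rw [X_pow_eq_monomial]
    have h2 : (expand hζ (X i)).natDegree ≤ 1 := by
      simp only [expand, aeval_X]
      compute_degree
    have h3 : (expand hζ (X i)).coeff 1 = algebraMap ℂ (constAlong v) (v i) := by
      simp [expand, Polynomial.coeff_C]
    rw [h1, map_pow, map_pow, Finsupp.degree_single]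
    have h4 := Polynomial.natDegree_pow_le_of_le k h2
    have h5 := Polynomial.coeff_pow_of_natDegree_le (m := k) h2
    rw [mul_one] at h4
    rw [mul_one] at h5
    exact ⟨h4, by rw [h5, h3]; simp⟩

theorem expand_homogeneous {v : Fin n → ℂ} {ζ : MvPolynomial (Fin n) ℂ} (hζ : dirDeriv v ζ = 1)
    {f : MvPolynomial (Fin n) ℂ} {N : ℕ} (hf : f.IsHomogeneous N) :
    (expand hζ f).natDegree ≤ N ∧
      (expand hζ f).coeff N = algebraMap ℂ (constAlong v) (eval v f) := by
  have h1 (d : Fin n →₀ ℕ) : monomial d (coeff d f) = coeff d f • monomial d (1 : ℂ) := by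
    simp [smul_monomial]
  have h2 (d) (hd : d ∈ f.support) : d.degree = N := by
    rw [Finsupp.degree_eq_weight_one]; exact hf (mem_support_iff.mp hd)
  rw [f.as_sum, map_sum, map_sum, map_sum, Polynomial.finsetSum_coeff]
  refine ⟨Polynomial.natDegree_sum_le_of_forall_le _ _ fun d hd => ?_,
    Finset.sum_congr rfl fun d hd => ?_⟩
  · rw [h1, map_smul, ← h2 d hd]
    exact (Polynomial.natDegree_smul_le _ _).trans (expand_monomial hζ d).1
  · rw [h1, map_smul, ← h2 d hd, Polynomial.coeff_smul, (expand_monomial hζ d).2,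
      MvPolynomial.smul_eval, map_mul, Algebra.smul_def]

/-- For ρ take the top homogeneous component of a nonzero g in J: the leading coefficient of g in ζ
is the scalar ρ(v), which can be divided out. -/
theorem exists_monic_of_generic {J : Ideal (MvPolynomial (Fin n) ℂ)} (hJ : J ≠ ⊥) :
    ∃ ρ : MvPolynomial (Fin n) ℂ, ρ ≠ 0 ∧ ∀ (v : Fin n → ℂ) (ζ : MvPolynomial (Fin n) ℂ),
      eval v ρ ≠ 0 → dirDeriv v ζ = 1 →
      ∃ G : Polynomial (constAlong v), G.Monic ∧ Polynomial.aeval ζ G ∈ J := by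
  obtain ⟨g, hg, hg0⟩ := Submodule.exists_mem_ne_zero_of_ne_bot hJ
  set S := (Finset.range (g.totalDegree + 1)).filter fun i => homogeneousComponent i g ≠ 0
  have hS : S.Nonempty := by
    by_contra h
    rw [Finset.not_nonempty_iff_eq_empty, Finset.filter_eq_empty_iff] at h
    apply hg0
    rw [← sum_homogeneousComponent g]
    exact Finset.sum_eq_zero fun i hi => not_not.mp (h hi)
  obtain ⟨N, hN, hmax⟩ := S.exists_max_image id hS
  refine ⟨homogeneousComponent N g, (Finset.mem_filter.mp hN).2, fun v ζ hv hζ => ?_⟩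
  have key (i) (hi : i ∈ Finset.range (g.totalDegree + 1)) :
      (expand hζ (homogeneousComponent i g)).natDegree ≤ N ∧
      (i ≠ N → (expand hζ (homogeneousComponent i g)).coeff N = 0) := by
    have h := expand_homogeneous hζ (homogeneousComponent_isHomogeneous i g)
    by_cases h0 : homogeneousComponent i g = 0
    · simp [h0]
    · have hiN : i ≤ N := hmax i (Finset.mem_filter.mpr ⟨hi, h0⟩)
      exact ⟨h.1.trans hiN, fun hne => Polynomial.coeff_eq_zero_of_natDegree_lt
        (h.1.trans_lt (lt_of_le_of_ne hiN hne))⟩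
  have hdeg : (expand hζ g).natDegree ≤ N := by
    rw [← sum_homogeneousComponent g, map_sum]
    exact Polynomial.natDegree_sum_le_of_forall_le _ _ fun i hi => (key i hi).1
  have hcoeff : (expand hζ g).coeff N =
      algebraMap ℂ (constAlong v) (eval v (homogeneousComponent N g)) := by
    conv_lhs => rw [← sum_homogeneousComponent g]
    rw [map_sum, Polynomial.finsetSum_coeff, Finset.sum_eq_single_of_mem N
      (Finset.mem_filter.mp hN).1 fun i hi hne => (key i hi).2 hne]
    exact (expand_homogeneous hζ (homogeneousComponent_isHomogeneous N g)).2
  set c := eval v (homogeneousComponent N g)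
  refine ⟨c⁻¹ • expand hζ g, ?_, ?_⟩
  · refine Polynomial.monic_of_natDegree_le_of_coeff_eq_one N
      ((Polynomial.natDegree_smul_le _ _).trans hdeg) ?_
    rw [Polynomial.coeff_smul, hcoeff, Algebra.smul_def, ← map_mul, inv_mul_cancel₀ hv, map_one]
  · have : Polynomial.aeval ζ (c⁻¹ • expand hζ g) = c⁻¹ • g := by
      rw [← AlgHom.coe_restrictScalars' ℂ, map_smul, AlgHom.coe_restrictScalars', aeval_expand]
    rw [this, MvPolynomial.smul_eq_C_mul]
    exact J.mul_mem_left _ hg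

/-- Division with remainder by G. The weak degree bound, valid also for G = 1, costs one spare term.
-/
theorem exists_sum_sub_mem {v : Fin n → ℂ} {ζ : MvPolynomial (Fin n) ℂ} (hζ : dirDeriv v ζ = 1)
    {J : Ideal (MvPolynomial (Fin n) ℂ)} {G : Polynomial (constAlong v)} (hG : G.Monic)
    (hGJ : Polynomial.aeval ζ G ∈ J) (f : MvPolynomial (Fin n) ℂ) :
    ∃ a : ℕ → constAlong v,
      f - ∑ i ∈ Finset.range (G.natDegree + 1), a i • ζ ^ i ∈ J := by
  refine ⟨fun i => (expand hζ f %ₘ G).coeff i, ?_⟩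
  rw [← Polynomial.aeval_eq_sum_range'
    (Nat.lt_succ_of_le (Polynomial.natDegree_modByMonic_le _ hG))]
  nth_rewrite 1 [← aeval_expand hζ f]
  rw [← map_sub]
  rw [show expand hζ f - expand hζ f %ₘ G = G * (expand hζ f /ₘ G) by
    rw [Polynomial.modByMonic_eq_sub_mul_div]; ring, map_mul]
  exact J.mul_mem_right _ hGJ

/-! ### Nakayama's lemma along a line. -/

/-- The functions constant along `v` which vanish at `w`. -/
def constAlongIdeal (v w : Fin n → ℂ) : Ideal (constAlong v) :=
  RingHom.ker ((eval w).comp (constAlong v).val.toRingHom)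

theorem mem_constAlongIdeal {v w : Fin n → ℂ} {a : constAlong v} :
    a ∈ constAlongIdeal v w ↔ eval w (a : MvPolynomial (Fin n) ℂ) = 0 := Iff.rfl

theorem lineEval_coordinate {v w : Fin n → ℂ} {ζ : MvPolynomial (Fin n) ℂ}
    (hζ : dirDeriv v ζ = 1) (hζw : eval w ζ = 0) : lineEval w v ζ = Polynomial.X := by
  refine Polynomial.funext fun t => ?_
  rw [eval_lineEval, eval_add_smul_of_linear (by simp [hζ]), hζ, hζw]
  simp

theorem lineEval_surjective {v w : Fin n → ℂ} {ζ : MvPolynomial (Fin n) ℂ}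
    (hζ : dirDeriv v ζ = 1) (hζw : eval w ζ = 0) : Function.Surjective (lineEval w v) := by
  intro p
  refine ⟨Polynomial.aeval ζ p, ?_⟩
  rw [← Polynomial.aeval_algHom_apply, lineEval_coordinate hζ hζw]
  simp

/-- On the line ζ is the parameter and the coefficients of the ζ-expansion are their values at w, so
all these values vanish. -/
theorem mem_ideal_smul_top_of_lineEval_eq_zero {v w : Fin n → ℂ} {ζ : MvPolynomial (Fin n) ℂ}
    (hζ : dirDeriv v ζ = 1) (hζw : eval w ζ = 0) {f : MvPolynomial (Fin n) ℂ}
    (hf : lineEval w v f = 0) :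
    f ∈ constAlongIdeal v w • (⊤ : Submodule (constAlong v) (MvPolynomial (Fin n) ℂ)) := by
  set P := expand hζ f with hP
  have hfP : f = ∑ i ∈ Finset.range (P.natDegree + 1), P.coeff i • ζ ^ i := by
    rw [← Polynomial.aeval_eq_sum_range' (Nat.lt_succ_self _), hP, aeval_expand]
  have hcoeff (i : ℕ) (hi : i ∈ Finset.range (P.natDegree + 1)) :
      eval w (P.coeff i : MvPolynomial (Fin n) ℂ) = 0 := by
    rw [hfP, map_sum] at hf
    have h := congrArg (fun q => Polynomial.coeff q i) hf
    simp only [Subalgebra.smul_def, smul_eq_mul, map_mul, map_pow, lineEval_coordinate hζ hζw,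
      lineEval_eq_C (mem_constAlong.mp (P.coeff _).2), Polynomial.finsetSum_coeff,
      Polynomial.coeff_C_mul_X_pow, Polynomial.coeff_zero] at h
    rwa [Finset.sum_ite_eq, if_pos hi] at h
  rw [hfP]
  exact Submodule.sum_mem _ fun i hi => Submodule.smul_mem_smul
    (mem_constAlongIdeal.mpr (hcoeff i hi)) Submodule.mem_top

/-- Nakayama for M/W, which is finite and equal to m(M/W), although M itself need not be finite. -/
theorem exists_smul_mem_of_fg_mod {A M : Type*} [CommRing A] [AddCommGroup M] [Module A M]
    (m : Ideal A) (W : Submodule A M) {d : ℕ} (e : ℕ → M)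
    (he : ∀ f, ∃ a : ℕ → A, f - ∑ i ∈ Finset.range d, a i • e i ∈ W)
    (hW : ∀ f, ∃ g ∈ W, f - g ∈ m • (⊤ : Submodule A M)) :
    ∃ s : A, s - 1 ∈ m ∧ ∀ f, s • f ∈ W := by
  have hfin : Module.Finite A (M ⧸ W) := by
    refine Module.Finite.of_surjective (W.mkQ.comp (Fintype.linearCombination A
      fun j : Fin d => e j)) fun m => ?_
    obtain ⟨f, rfl⟩ := W.mkQ_surjective m
    obtain ⟨a, ha⟩ := he f
    refine ⟨fun j => a j, ?_⟩
    rw [LinearMap.comp_apply, Fintype.linearCombination_apply, ← sub_eq_zero, ← map_sub,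
      Submodule.mkQ_apply, Submodule.Quotient.mk_eq_zero, ← neg_sub, W.neg_mem_iff,
      Fin.sum_univ_eq_sum_range (fun i => a i • e i)]
    exact ha
  obtain ⟨s, hs, hs0⟩ := Submodule.exists_sub_one_mem_and_smul_eq_zero_of_fg_of_le_smul
    m (⊤ : Submodule A (M ⧸ W)) hfin.fg_top (by
      intro x _
      obtain ⟨f, rfl⟩ := W.mkQ_surjective x
      obtain ⟨g, hg, hfg⟩ := hW f
      have h' := Submodule.mem_map_of_mem (f := W.mkQ) hfg
      have hg0 : W.mkQ g = 0 := (Submodule.Quotient.mk_eq_zero W).mpr hg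
      rw [Submodule.map_smul'', map_sub, hg0, sub_zero] at h'
      exact Submodule.smul_mono le_rfl le_top h')
  refine ⟨s, hs, fun f => ?_⟩
  have := hs0 (W.mkQ f) Submodule.mem_top
  rwa [← map_smul, Submodule.mkQ_apply, Submodule.Quotient.mk_eq_zero] at this

/-- Nakayama's lemma along a line: a `constAlong v`-submodule which contains an ideal that is
finite in the direction `v`, and which restricts onto all polynomials on the line through `w`,
is everything near the image of `w`. -/
theorem exists_mul_mem_of_lineEval {v w : Fin n → ℂ} {ζ : MvPolynomial (Fin n) ℂ}
    (hζ : dirDeriv v ζ = 1) (hζw : eval w ζ = 0) {J : Ideal (MvPolynomial (Fin n) ℂ)}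
    {G : Polynomial (constAlong v)} (hG : G.Monic) (hGJ : Polynomial.aeval ζ G ∈ J)
    (W : Submodule (constAlong v) (MvPolynomial (Fin n) ℂ)) (hJW : ∀ f ∈ J, f ∈ W)
    (hW : ∀ f, ∃ g ∈ W, lineEval w v f = lineEval w v g) :
    ∃ s : MvPolynomial (Fin n) ℂ, dirDeriv v s = 0 ∧ eval w s ≠ 0 ∧ ∀ f, s * f ∈ W := by
  obtain ⟨s, hs, hsW⟩ := exists_smul_mem_of_fg_mod (constAlongIdeal v w) W (fun i => ζ ^ i)
    (fun f => (exists_sum_sub_mem hζ hG hGJ f).imp fun a ha => hJW _ ha)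
    (fun f => (hW f).imp fun g hg => ⟨hg.1, mem_ideal_smul_top_of_lineEval_eq_zero hζ hζw
      (by rw [map_sub, hg.2, sub_self])⟩)
  refine ⟨s, s.2, ?_, hsW⟩
  rw [mem_constAlongIdeal] at hs
  have : eval w (s : MvPolynomial (Fin n) ℂ) = 1 := by
    simpa [sub_eq_zero] using hs
  simp [this]

/-! ### Krull dimension: integral extensions, cones and conductors. -/

theorem ringKrullDim_le_of_isIntegral {R S : Type*} [CommRing R] [CommRing S] [Algebra R S]
    [Algebra.IsIntegral R S] (hinj : Function.Injective (algebraMap R S)) :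
    ringKrullDim R ≤ ringKrullDim S := by
  have lift (l : LTSeries (PrimeSpectrum R)) : ∃ l' : LTSeries (PrimeSpectrum S),
      l'.length = l.length ∧ l'.last.asIdeal.comap (algebraMap R S) = l.last.asIdeal := by
    -- Going up lifts the chain one prime at a time.
    induction l using RelSeries.inductionOn' with
    | singleton x =>
      obtain ⟨Q, -, hQ, hQx⟩ := Ideal.exists_ideal_over_prime_of_isIntegral x.asIdeal (⊥ : Ideal S)
        (by rw [Ideal.comap_bot_of_injective _ hinj]; exact bot_le)
      exact ⟨RelSeries.singleton _ ⟨Q, hQ⟩, rfl, hQx⟩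
    | snoc p x hx hp =>
      obtain ⟨l, hl, hlast⟩ := hp
      have hlt : p.last.asIdeal < x.asIdeal := hx
      obtain ⟨Q, hle, hQ, hQx⟩ := Ideal.exists_ideal_over_prime_of_isIntegral x.asIdeal
        l.last.asIdeal (hlast.trans_le hlt.le)
      have hlQ : l.last < ⟨Q, hQ⟩ := by
        refine lt_of_le_of_ne hle fun h => hlt.ne ?_
        rw [← hlast, ← hQx, h]
      exact ⟨l.snoc ⟨Q, hQ⟩ hlQ, by simp [hl], by simpa using hQx⟩
  refine iSup_le fun l => ?_
  obtain ⟨l', hl', -⟩ := lift l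
  exact hl' ▸ Order.LTSeries.length_le_krullDim l'

/-- Some minimal prime p of R contracts to zero, so the polynomial ring embeds in the domain R/p;
compare transcendence degrees with a Noether normalization of R/p. -/
theorem le_ringKrullDim_of_injective {K R : Type} [Field K] [CommRing R] [Algebra K R]
    [Algebra.FiniteType K R] {m : ℕ} (φ : MvPolynomial (Fin m) K →ₐ[K] R)
    (hφ : Function.Injective φ) : (m : WithBot ℕ∞) ≤ ringKrullDim R := by
  obtain ⟨p, hp, hpφ⟩ := Ideal.exists_comap_eq_of_mem_minimalPrimes_of_injective
    (f := (φ : MvPolynomial (Fin m) K →+* R)) hφ ⊥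
    (by rw [IsDomain.minimalPrimes_eq_singleton_bot]; rfl)
  have hψ : Function.Injective ((Ideal.Quotient.mkₐ K p).comp φ) := by
    rw [injective_iff_map_eq_zero]
    intro a ha
    have : a ∈ p.comap (φ : MvPolynomial (Fin m) K →+* R) := by
      rw [AlgHom.comp_apply, Ideal.Quotient.mkₐ_eq_mk, Ideal.Quotient.eq_zero_iff_mem] at ha
      exact ha
    rwa [hpφ, Ideal.mem_bot] at this
  obtain ⟨d, g, hg, hgint⟩ := exists_integral_inj_algHom_of_fg K (R ⧸ p)
  algebraize [g.toRingHom]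
  have hginj : Function.Injective (algebraMap (MvPolynomial (Fin d) K) (R ⧸ p)) := hg
  have hdim : ringKrullDim (MvPolynomial (Fin d) K) ≤ ringKrullDim (R ⧸ p) :=
    ringKrullDim_le_of_isIntegral hginj
  have hfaith : FaithfulSMul (MvPolynomial (Fin d) K) (R ⧸ p) :=
    (faithfulSMul_iff_algebraMap_injective _ _).mpr hginj
  have htower : IsScalarTower K (MvPolynomial (Fin d) K) (R ⧸ p) :=
    IsScalarTower.of_algebraMap_eq fun x => (g.commutes x).symm
  have htr := trdeg_add_eq K (MvPolynomial (Fin d) K) (A := R ⧸ p)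
  rw [trdeg_eq_zero (R := MvPolynomial (Fin d) K), add_zero] at htr
  have hle := trdeg_le_of_injective _ hψ
  rw [← htr, MvPolynomial.trdeg_of_isDomain, MvPolynomial.trdeg_of_isDomain] at hle
  have hmd : m ≤ d := by simpa using hle
  rw [MvPolynomial.ringKrullDim_of_isNoetherianRing, ringKrullDim_eq_zero_of_field, zero_add,
    Nat.card_fin] at hdim
  refine le_trans ?_ (hdim.trans (ringKrullDim_quotient_le p))
  exact_mod_cast hmd

theorem not_le_add_one_of_add_two_le {d : WithBot ℕ∞} (h2 : d + 2 ≤ n) :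
    ¬ (n : WithBot ℕ∞) ≤ d + 1 := by
  intro h1
  induction d using WithBot.recBotCoe with
  | bot => simp at h1
  | coe d =>
    change ((d + 2 : ℕ∞) : WithBot ℕ∞) ≤ ((n : ℕ∞) : WithBot ℕ∞) at h2
    change ((n : ℕ∞) : WithBot ℕ∞) ≤ ((d + 1 : ℕ∞) : WithBot ℕ∞) at h1
    rw [WithBot.coe_le_coe] at h1 h2
    induction d using ENat.recTopCoe with
    | top => simp at h2
    | coe d =>
      have h3 : d + 2 ≤ n := by exact_mod_cast h2
      have h4 : n ≤ d + 1 := by exact_mod_cast h1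
      omega

/-- The lines through `w` and a point of an algebraic set of codimension at least two lie on a
hypersurface. -/
theorem exists_cone {J : Ideal (MvPolynomial (Fin n) ℂ)}
    (hJ : ringKrullDim (MvPolynomial (Fin n) ℂ ⧸ J) + 2 ≤ n) (w : Fin n → ℂ) :
    ∃ ρ : MvPolynomial (Fin n) ℂ, ρ ≠ 0 ∧
      ∀ p ∈ zeroLocus ℂ J, ∀ t : ℂ, eval (t • (p - w)) ρ = 0 := by
  -- The comorphism of (p, t) ↦ t(p - w). Its source has dimension at most n - 1, so φ has a nonzero
  -- kernel element, which cuts out the hypersurface.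
  set φ : MvPolynomial (Fin n) ℂ →ₐ[ℂ] Polynomial (MvPolynomial (Fin n) ℂ ⧸ J) :=
    aeval (R := ℂ) fun i =>
      Polynomial.X * Polynomial.C (Ideal.Quotient.mk J (X i - C (w i))) with hφ
  have hninj : ¬ Function.Injective φ := by
    intro h
    have h1 := le_ringKrullDim_of_injective (K := ℂ)
      (R := Polynomial (MvPolynomial (Fin n) ℂ ⧸ J)) φ h
    rw [Polynomial.ringKrullDim_of_isNoetherianRing] at h1
    exact not_le_add_one_of_add_two_le hJ h1
  rw [injective_iff_map_eq_zero] at hninj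
  push Not at hninj
  obtain ⟨ρ, h0, hρ⟩ := hninj
  refine ⟨ρ, hρ, fun p hp t => ?_⟩
  set e : (MvPolynomial (Fin n) ℂ ⧸ J) →ₐ[ℂ] ℂ := Ideal.Quotient.liftₐ J (aeval p)
    fun a ha => by exact hp a ha
  have hcomp : (Polynomial.eval₂RingHom (e : MvPolynomial (Fin n) ℂ ⧸ J →+* ℂ) t).comp
      (φ : MvPolynomial (Fin n) ℂ →+* _) = eval (t • (p - w)) := by
    refine MvPolynomial.ringHom_ext (fun c => ?_) fun i => ?_
    · rw [RingHom.comp_apply, RingHom.coe_coe, ← MvPolynomial.algebraMap_eq, φ.commutes,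
        Polynomial.algebraMap_apply, Polynomial.coe_eval₂RingHom, Polynomial.eval₂_C,
        RingHom.coe_coe, e.commutes, MvPolynomial.algebraMap_eq, eval_C]
      rfl
    · have : e (Ideal.Quotient.mk J (X i - C (w i))) = p i - w i := by
        change aeval p (X i - C (w i)) = p i - w i
        simp
      rw [RingHom.comp_apply, RingHom.coe_coe, hφ, aeval_X, eval_X, Polynomial.coe_eval₂RingHom,
        Polynomial.eval₂_mul, Polynomial.eval₂_X, Polynomial.eval₂_C, RingHom.coe_coe, this]
      rfl
  have h2 := DFunLike.congr_fun hcomp ρ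
  rw [RingHom.comp_apply, RingHom.coe_coe, h0, map_zero] at h2
  exact h2.symm

theorem ne_bot_of_codim {J : Ideal (MvPolynomial (Fin n) ℂ)}
    (hJ : ringKrullDim (MvPolynomial (Fin n) ℂ ⧸ J) + 2 ≤ n) : J ≠ ⊥ := by
  rintro rfl
  obtain ⟨ρ, hρ, h⟩ := exists_cone hJ 0
  refine hρ (MvPolynomial.funext fun v => ?_)
  simpa using h v (by simp) 1

/-- Prime avoidance yields s in c outside every minimal prime of B. As B is reduced, s is a
nonzerodivisor on A/ker φ, so dividing by c drops the dimension; and dim A/ker φ ≤ dim B by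
integrality. -/
theorem ringKrullDim_quotient_succ_le {A B : Type*} [CommRing A] [CommRing B] [IsReduced B]
    [IsNoetherianRing B] (φ : A →+* B) (hφ : φ.IsIntegral) (c : Ideal A) (hc : RingHom.ker φ ≤ c)
    (hmin : ∀ P ∈ minimalPrimes B, ∃ s ∈ c, φ s ∉ P) :
    ringKrullDim (A ⧸ c) + 1 ≤ ringKrullDim B := by
  obtain ⟨s, hs, hsP⟩ : ∃ s ∈ c, ∀ P ∈ minimalPrimes B, φ s ∉ P := by
    by_contra hcon
    push Not at hcon
    have hsub : (c : Set A) ⊆ ⋃ P ∈ minimalPrimes B, (P.comap φ : Set A) := by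
      intro s hs
      obtain ⟨P, hP, hsP⟩ := hcon s hs
      exact Set.mem_biUnion hP hsP
    rw [Ideal.subset_union_prime_finite (minimalPrimes.finite_of_isNoetherianRing B)
      (f := fun P => P.comap φ) ⊥ ⊥ (fun P hP _ _ => by
        have := Ideal.IsMinimalPrime.isPrime hP
        exact Ideal.IsPrime.comap φ)] at hsub
    obtain ⟨P, hP, hcP⟩ := hsub
    obtain ⟨s, hs, hsP⟩ := hmin P hP
    exact hsP (hcP hs)
  have hs0 : Ideal.Quotient.mk (RingHom.ker φ) s ∈ nonZeroDivisors (A ⧸ RingHom.ker φ) := by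
    rw [mem_nonZeroDivisors_iff_right]
    intro x hx
    obtain ⟨a, rfl⟩ := Ideal.Quotient.mk_surjective x
    rw [← map_mul, Ideal.Quotient.eq_zero_iff_mem, RingHom.mem_ker, map_mul] at hx
    rw [Ideal.Quotient.eq_zero_iff_mem, RingHom.mem_ker]
    have hmem : φ a ∈ sInf (minimalPrimes B) := by
      rw [Ideal.mem_sInf]
      intro P hP
      have := Ideal.IsMinimalPrime.isPrime hP
      exact (this.mem_or_mem (hx ▸ P.zero_mem)).resolve_right (hsP P hP)
    rw [minimalPrimes, Ideal.sInf_minimalPrimes] at hmem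
    exact IsReduced.eq_zero _ hmem
  have h1 := ringKrullDim_succ_le_of_surjective (Ideal.Quotient.factor hc)
    (Ideal.Quotient.factor_surjective hc) hs0
    (by rw [Ideal.Quotient.factor_mk, Ideal.Quotient.eq_zero_iff_mem]; exact hs)
  refine h1.trans ?_
  let := (RingHom.kerLift φ).toAlgebra
  have : Algebra.IsIntegral (A ⧸ RingHom.ker φ) B := by
    refine ⟨fun b => ?_⟩
    have hb : (RingHom.kerLift φ).IsIntegralElem b := by
      refine RingHom.IsIntegralElem.of_comp (f := Ideal.Quotient.mk (RingHom.ker φ)) ?_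
      exact hφ b
    exact hb
  exact ringKrullDim_le_of_isIntegral (RingHom.kerLift_injective φ)

/-! ### Linear coordinates and ideals on a line. -/

theorem exists_eval_ne_zero {ρ : MvPolynomial (Fin n) ℂ} (hρ : ρ ≠ 0) :
    ∃ v, eval v ρ ≠ 0 := by
  by_contra! h
  exact hρ (MvPolynomial.funext fun v => by simpa using h v)

theorem exists_coordinate {v : Fin n → ℂ} (hv : v ≠ 0) (w : Fin n → ℂ) :
    ∃ ζ, dirDeriv v ζ = 1 ∧ eval w ζ = 0 := by
  obtain ⟨i, hi⟩ := Function.ne_iff.mp hv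
  refine ⟨C (v i)⁻¹ * (X i - C (w i)), ?_, by simp⟩
  have hi' : v i ≠ 0 := hi
  rw [← MvPolynomial.smul_eq_C_mul, Derivation.map_smul, map_sub, dirDeriv_X,
    ← MvPolynomial.algebraMap_eq, Derivation.map_algebraMap, sub_zero, MvPolynomial.algebraMap_eq,
    MvPolynomial.smul_eq_C_mul, ← C_mul, inv_mul_cancel₀ hi', C_1]

theorem exists_dual_coordinates (hn : 2 ≤ n) {v : Fin n → ℂ} (hv : v ≠ 0) (w : Fin n → ℂ) :
    ∃ δ : MvPolynomial (Fin n) ℂ, δ ≠ 0 ∧ ∀ u, eval u δ ≠ 0 → ∃ ζ η,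
      dirDeriv v ζ = 1 ∧ dirDeriv u ζ = 0 ∧ dirDeriv u η = 1 ∧ dirDeriv v η = 0 ∧
        eval w ζ = 0 := by
  obtain ⟨i, hi⟩ := Function.ne_iff.mp hv
  replace hi : v i ≠ 0 := hi
  have : Nontrivial (Fin n) := Fin.nontrivial_iff_two_le.mpr hn
  obtain ⟨j, hj⟩ := exists_ne i
  -- At u this is a 2 × 2 minor of (v, u); once it is nonzero, Cramer's rule gives ζ and η.
  refine ⟨v i • X j - v j • X i, fun h => hi ?_, fun u hu => ?_⟩
  · have := congrArg (eval (Pi.single j 1)) h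
    simpa [hj.symm] using this
  · have hΔ : v i * u j - v j * u i ≠ 0 := by simpa using hu
    set Δ := v i * u j - v j * u i with hΔdef
    have hC (a : ℂ) (w : Fin n → ℂ) : dirDeriv w (C a) = 0 := by
      rw [← MvPolynomial.algebraMap_eq, Derivation.map_algebraMap]
    have hD (w a b : Fin n → ℂ) (c d : ℂ) :
        dirDeriv w (Δ⁻¹ • (c • (X i - C (a i)) - d • (X j - C (b j)))) =
          C (Δ⁻¹ * (c * w i - d * w j)) := by
      simp only [Derivation.map_smul, map_sub, dirDeriv_X, hC, sub_zero]
      simp only [MvPolynomial.smul_eq_C_mul, ← C_mul, ← C_sub]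
    refine ⟨Δ⁻¹ • (u j • (X i - C (w i)) - u i • (X j - C (w j))),
      Δ⁻¹ • (-v j • (X i - C ((0 : Fin n → ℂ) i)) - -v i • (X j - C ((0 : Fin n → ℂ) j))),
      ?_, ?_, ?_, ?_, by simp⟩
    · rw [hD, show u j * v i - u i * v j = Δ by rw [hΔdef]; ring, inv_mul_cancel₀ hΔ, C_1]
    · rw [hD, show u j * u i - u i * u j = 0 by ring, mul_zero, C_0]
    · rw [hD, show -v j * u i - -v i * u j = Δ by rw [hΔdef]; ring, inv_mul_cancel₀ hΔ, C_1]
    · rw [hD, show -v j * v i - -v i * v j = 0 by ring, mul_zero, C_0]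

theorem _root_.Ideal.eq_top_of_forall_exists_eval_ne_zero (j : Ideal (Polynomial ℂ))
    (h : ∀ t, ∃ p ∈ j, p.eval t ≠ 0) : j = ⊤ := by
  obtain ⟨e, rfl⟩ := (IsPrincipalIdealRing.principal j).principal
  have he (t : ℂ) : ¬ e.IsRoot t := by
    intro ht
    obtain ⟨p, hp, hpt⟩ := h t
    obtain ⟨q, rfl⟩ := Ideal.mem_span_singleton.mp hp
    exact hpt (by rw [Polynomial.eval_mul, ht.eq_zero, zero_mul])
  rw [Ideal.submodule_span_eq, Ideal.span_singleton_eq_top, Polynomial.isUnit_iff_degree_eq_zero]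
  by_contra hdeg
  obtain ⟨t, ht⟩ := IsAlgClosed.exists_root e hdeg
  exact he t ht

/-- A generator has no root except possibly 0, hence is a unit times a power of the variable; an
element with nonzero derivative at 0 bounds the exponent by one. -/
theorem _root_.Ideal.X_mem_of_forall_exists_eval_ne_zero (j : Ideal (Polynomial ℂ))
    (h : ∀ t ≠ 0, ∃ p ∈ j, p.eval t ≠ 0)
    (h0 : ∃ p ∈ j, (Polynomial.derivative p).eval 0 ≠ 0) : Polynomial.X ∈ j := by
  obtain ⟨e, rfl⟩ := (IsPrincipalIdealRing.principal j).principal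
  rw [Ideal.submodule_span_eq] at *
  obtain ⟨p, hp, hp0⟩ := h0
  have he0 : e ≠ 0 := by
    rintro rfl
    rw [Ideal.mem_span_singleton, zero_dvd_iff] at hp
    simp [hp] at hp0
  obtain ⟨q, hq, hndvd⟩ := e.exists_eq_pow_rootMultiplicity_mul_and_not_dvd he0 0
  rw [Polynomial.C_0, sub_zero] at hq hndvd
  set k := e.rootMultiplicity 0
  have hqu : IsUnit q := by
    rw [Polynomial.isUnit_iff_degree_eq_zero]
    by_contra hdeg
    obtain ⟨t, ht⟩ := IsAlgClosed.exists_root q hdeg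
    by_cases ht0 : t = 0
    · subst ht0
      exact hndvd (by simpa using Polynomial.dvd_iff_isRoot.mpr ht)
    · obtain ⟨p, hp, hpt⟩ := h t ht0
      obtain ⟨q', rfl⟩ := Ideal.mem_span_singleton.mp hp
      exact hpt (by rw [Polynomial.eval_mul, hq, Polynomial.eval_mul, ht.eq_zero]; ring)
  have hk : k ≤ 1 := by
    by_contra hk
    obtain ⟨q', rfl⟩ := Ideal.mem_span_singleton.mp hp
    have h2 : Polynomial.X ^ 2 ∣ e * q' := by
      rw [hq]
      exact Dvd.dvd.mul_right (Dvd.dvd.mul_right (pow_dvd_pow _ (by omega)) _) _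
    obtain ⟨q'', hq''⟩ := h2
    apply hp0
    rw [hq'']
    simp [Polynomial.derivative_mul]
  rw [Ideal.mem_span_singleton, hq, hqu.mul_right_dvd]
  exact (pow_dvd_pow _ hk).trans (by simp)

/-! ### Generic linear projections near a point. -/

/-- Off an algebraic set of codimension at least two, some equation of its image under a generic
linear projection does not vanish. -/
theorem exists_mem_constAlong_of_generic (hn : 2 ≤ n) {J : Ideal (MvPolynomial (Fin n) ℂ)}
    (hJ : ringKrullDim (MvPolynomial (Fin n) ℂ ⧸ J) + 2 ≤ n) {w : Fin n → ℂ}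
    (hw : w ∉ zeroLocus ℂ J) :
    ∃ ρ : MvPolynomial (Fin n) ℂ, ρ ≠ 0 ∧ ∀ v, eval v ρ ≠ 0 →
      v ≠ 0 ∧ ∃ s ∈ J, dirDeriv v s = 0 ∧ eval w s ≠ 0 := by
  obtain ⟨ρ₁, h₁, hcone⟩ := exists_cone hJ w
  obtain ⟨ρ₂, h₂, hmonic⟩ := exists_monic_of_generic (ne_bot_of_codim hJ)
  -- The factors ensure in turn that the line through w along v misses the zero set, that J is
  -- finite along v, and that v ≠ 0.
  refine ⟨ρ₁ * ρ₂ * X ⟨0, by omega⟩, mul_ne_zero (mul_ne_zero h₁ h₂) (X_ne_zero _),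
    fun v hv => ?_⟩
  simp only [map_mul, mul_ne_zero_iff, eval_X] at hv
  have hv0 : v ≠ 0 := fun h => hv.2 (by simp [h])
  obtain ⟨ζ, hζ, hζw⟩ := exists_coordinate hv0 w
  obtain ⟨G, hG, hGJ⟩ := hmonic v ζ hv.1.2 hζ
  have hline (t : ℂ) : ∃ j ∈ J, eval (w + t • v) j ≠ 0 := by
    by_contra! hcon
    have hmem : w + t • v ∈ zeroLocus ℂ J := fun j hj => by
      simpa [MvPolynomial.aeval_eq_eval] using hcon j hj
    have ht : t ≠ 0 := by
      rintro rfl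
      exact hw (by simpa using hmem)
    have := hcone _ hmem t⁻¹
    rw [add_sub_cancel_left, inv_smul_smul₀ ht] at this
    exact hv.1.1 this
  have htop : J.map (lineEval w v) = ⊤ := by
    refine Ideal.eq_top_of_forall_exists_eval_ne_zero _ fun t => ?_
    obtain ⟨j, hj, hjt⟩ := hline t
    exact ⟨lineEval w v j, Ideal.mem_map_of_mem _ hj, by rwa [eval_lineEval]⟩
  obtain ⟨s, hsv, hsw, hs⟩ := exists_mul_mem_of_lineEval hζ hζw hG hGJ
    (J.restrictScalars (constAlong v)) (fun f hf => hf) (fun f => by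
      have hmem : lineEval w v f ∈ J.map (lineEval w v) := by
        rw [htop]; exact Submodule.mem_top
      obtain ⟨g, hg, hgf⟩ := (Ideal.mem_map_iff_of_surjective
        (lineEval w v) (lineEval_surjective hζ hζw)).mp hmem
      exact ⟨g, hg, hgf.symm⟩)
  exact ⟨hv0, s, by simpa using hs 1, hsv, hsw⟩

/-- The sums of an element of `J` and a polynomial constant along `v`. -/
def constAlongAdd (v : Fin n → ℂ) (J : Ideal (MvPolynomial (Fin n) ℂ)) :
    Submodule (constAlong v) (MvPolynomial (Fin n) ℂ) :=
  LinearMap.range (Algebra.linearMap (constAlong v) (MvPolynomial (Fin n) ℂ)) ⊔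
    J.restrictScalars (constAlong v)

theorem mem_constAlongAdd {v : Fin n → ℂ} {J : Ideal (MvPolynomial (Fin n) ℂ)}
    {f : MvPolynomial (Fin n) ℂ} :
    f ∈ constAlongAdd v J ↔ ∃ a, dirDeriv v a = 0 ∧ f - a ∈ J := by
  rw [constAlongAdd, Submodule.mem_sup]
  constructor
  · rintro ⟨_, ⟨a, rfl⟩, j, hj, rfl⟩
    exact ⟨a, a.2, by simpa [Subalgebra.algebraMap_def] using hj⟩
  · rintro ⟨a, ha, hfa⟩
    exact ⟨a, ⟨⟨a, ha⟩, rfl⟩, f - a, hfa, by ring⟩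

theorem dirDeriv_eq_sum (v : Fin n → ℂ) (f : MvPolynomial (Fin n) ℂ) :
    dirDeriv v f = ∑ i, C (v i) * pderiv i f := by
  have : dirDeriv v = ∑ i, (C (v i) : MvPolynomial (Fin n) ℂ) • (pderiv i : VF n) := by
    refine MvPolynomial.derivation_ext fun j => ?_
    rw [dirDeriv_X, ← Derivation.coeFnAddMonoidHom_apply, map_sum, Finset.sum_apply]
    simp [pderiv_X, Pi.single_apply]
  rw [this, ← Derivation.coeFnAddMonoidHom_apply, map_sum, Finset.sum_apply]
  simp

/-- Near a point at which the Zariski tangent space is not everything, a generic linear projection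
of an algebraic set of codimension at least two is an embedding. -/
theorem exists_mul_mem_constAlongAdd_of_generic
    {J : Ideal (MvPolynomial (Fin n) ℂ)}
    (hJ : ringKrullDim (MvPolynomial (Fin n) ℂ ⧸ J) + 2 ≤ n) {w : Fin n → ℂ}
    (hw : ∃ f ∈ J, ∃ v, eval w (dirDeriv v f) ≠ 0) :
    ∃ ρ : MvPolynomial (Fin n) ℂ, ρ ≠ 0 ∧ ∀ v, eval v ρ ≠ 0 →
      ∃ s, dirDeriv v s = 0 ∧ eval w s ≠ 0 ∧ ∀ g, s * g ∈ constAlongAdd v J := by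
  obtain ⟨ρ₁, h₁, hcone⟩ := exists_cone hJ w
  obtain ⟨ρ₂, h₂, hmonic⟩ := exists_monic_of_generic (ne_bot_of_codim hJ)
  obtain ⟨f, hf, v₀, hfv₀⟩ := hw
  set ρ₃ : MvPolynomial (Fin n) ℂ := ∑ i, C (eval w (pderiv i f)) * X i with hρ₃
  have heval (v : Fin n → ℂ) : eval v ρ₃ = eval w (dirDeriv v f) := by
    rw [dirDeriv_eq_sum, hρ₃, map_sum, map_sum]
    simp [mul_comm]
  have h₃ : ρ₃ ≠ 0 := by
    intro h
    rw [← heval, h, map_zero] at hfv₀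
    exact hfv₀ rfl
  -- Here ρ₃(v) = df_w(v) ≠ 0 makes the line transverse at w, so its scheme-theoretic intersection
  -- with the zero set is at most the reduced point w.
  refine ⟨ρ₁ * ρ₂ * ρ₃, mul_ne_zero (mul_ne_zero h₁ h₂) h₃, fun v hv => ?_⟩
  simp only [map_mul, mul_ne_zero_iff, heval] at hv
  have hv0 : v ≠ 0 := fun h => hv.2 (by simp [h, dirDeriv_zero])
  obtain ⟨ζ, hζ, hζw⟩ := exists_coordinate hv0 w
  obtain ⟨G, hG, hGJ⟩ := hmonic v ζ hv.1.2 hζ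
  have hX : Polynomial.X ∈ J.map (lineEval w v) := by
    refine Ideal.X_mem_of_forall_exists_eval_ne_zero _ (fun t ht => ?_)
      ⟨lineEval w v f, Ideal.mem_map_of_mem _ hf, ?_⟩
    · by_contra! hcon
      have hmem : w + t • v ∈ zeroLocus ℂ J := fun j hj => by
        rw [MvPolynomial.aeval_eq_eval, ← eval_lineEval]
        exact hcon _ (Ideal.mem_map_of_mem _ hj)
      have := hcone _ hmem t⁻¹
      rw [add_sub_cancel_left, inv_smul_smul₀ ht] at this
      exact hv.1.1 this
    · rw [derivative_lineEval, eval_lineEval]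
      simpa using hv.2
  obtain ⟨j, hj, hjX⟩ := (Ideal.mem_map_iff_of_surjective
    (lineEval w v) (lineEval_surjective hζ hζw)).mp hX
  replace hjX : lineEval w v j = Polynomial.X := hjX
  refine exists_mul_mem_of_lineEval hζ hζw hG hGJ (constAlongAdd v J)
    (fun f hf => mem_constAlongAdd.mpr ⟨0, by simp, by simpa using hf⟩) fun g => ?_
  -- On the line, g is its constant term plus a multiple of the parameter, and the parameter is the
  -- restriction of j in J.
  obtain ⟨q, hq⟩ := lineEval_surjective hζ hζw (lineEval w v g).divX
  refine ⟨q * j + C ((lineEval w v g).coeff 0), mem_constAlongAdd.mpr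
    ⟨C ((lineEval w v g).coeff 0), ?_, ?_⟩, ?_⟩
  · rw [← MvPolynomial.algebraMap_eq, Derivation.map_algebraMap]
  · simpa using J.mul_mem_left q hj
  · rw [map_add, map_mul, hq, hjX, ← MvPolynomial.algebraMap_eq, AlgHom.commutes,
      Polynomial.algebraMap_eq, Polynomial.divX_mul_X_add]

/-! ### The conductor of a projection and the graph description. -/

/-- The linear projection along `v` onto the hyperplane `ζ = 0`, on the level of functions. -/
def projAlong {v : Fin n → ℂ} {ζ : MvPolynomial (Fin n) ℂ} (hζ : dirDeriv v ζ = 1) :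
    MvPolynomial (Fin n) ℂ →ₐ[ℂ] constAlong v :=
  aeval (transverseCoord hζ)

theorem eval_projAlong {v : Fin n → ℂ} {ζ : MvPolynomial (Fin n) ℂ} (hζ : dirDeriv v ζ = 1)
    (p : Fin n → ℂ) (f : MvPolynomial (Fin n) ℂ) :
    eval p (projAlong hζ f : MvPolynomial (Fin n) ℂ) = eval (p + (-eval p ζ) • v) f := by
  induction f using MvPolynomial.induction_on with
  | C a =>
    rw [← MvPolynomial.algebraMap_eq, AlgHom.commutes, ← Subalgebra.val_apply, AlgHom.commutes,
      MvPolynomial.algebraMap_eq, eval_C, eval_C]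
  | add p q hp hq => simp [hp, hq]
  | mul_X q i hq =>
    rw [map_mul, Subalgebra.coe_mul, map_mul, hq, map_mul, projAlong, aeval_X]
    simp only [transverseCoord, map_sub, map_mul, eval_X, eval_C, Pi.add_apply, Pi.smul_apply,
      smul_eq_mul]
    ring

theorem projAlong_coe {v : Fin n → ℂ} {ζ : MvPolynomial (Fin n) ℂ} (hζ : dirDeriv v ζ = 1)
    (a : constAlong v) : projAlong hζ a = a := by
  refine Subtype.ext (MvPolynomial.funext fun p => ?_)
  rw [eval_projAlong, eval_add_smul_of_const (mem_constAlong.mp a.2)]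

/-- Since u is parallel to the hyperplane ζ = 0, projecting along v preserves constancy along u. -/
theorem dirDeriv_projAlong {u v : Fin n → ℂ} {ζ : MvPolynomial (Fin n) ℂ}
    (hζ : dirDeriv v ζ = 1) (hζu : dirDeriv u ζ = 0) (f : MvPolynomial (Fin n) ℂ) :
    dirDeriv u (projAlong hζ f : MvPolynomial (Fin n) ℂ) = projAlong hζ (dirDeriv u f) := by
  have hC (a : ℂ) : (projAlong hζ (C a) : MvPolynomial (Fin n) ℂ) = C a := by
    rw [← MvPolynomial.algebraMap_eq, AlgHom.commutes, ← Subalgebra.val_apply, AlgHom.commutes]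
  have hD (a : ℂ) : dirDeriv u (C a) = 0 := by
    rw [← MvPolynomial.algebraMap_eq, Derivation.map_algebraMap]
  induction f using MvPolynomial.induction_on with
  | C a => rw [hC, hD, map_zero]; rfl
  | add p q hp hq => simp only [map_add, Subalgebra.coe_add, hp, hq]
  | mul_X q i hq =>
    have hX : (projAlong hζ (X i) : MvPolynomial (Fin n) ℂ) = X i - C (v i) * ζ := by
      rw [projAlong, aeval_X]; rfl
    simp only [map_mul, Subalgebra.coe_mul, Derivation.leibniz, hq, map_add, Subalgebra.coe_add,
      smul_eq_mul, hX, map_sub, dirDeriv_X, hζu, hD, hC, mul_zero, add_zero, sub_zero]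

instance isNoetherianRing_constAlong_of_ne_zero {v : Fin n → ℂ} [hv : NeZero v] :
    IsNoetherianRing (constAlong v) := by
  obtain ⟨ζ, hζ, -⟩ := exists_coordinate hv.out 0
  exact isNoetherianRing_of_surjective _ _ (projAlong hζ).toRingHom
    fun a => ⟨a, projAlong_coe hζ a⟩

/-- The conductor of the image of the projection along `v` of the scheme defined by `J`. -/
def conductor (v : Fin n → ℂ) (J : Ideal (MvPolynomial (Fin n) ℂ)) : Ideal (constAlong v) where
  carrier := {s | ∀ g, (s : MvPolynomial (Fin n) ℂ) * g ∈ constAlongAdd v J}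
  add_mem' := fun {a b} ha hb g => by
    rw [Subalgebra.coe_add, add_mul]; exact add_mem (ha g) (hb g)
  zero_mem' := fun g => by simp
  smul_mem' := fun c s hs g => by
    rw [smul_eq_mul, Subalgebra.coe_mul, mul_assoc]
    exact (constAlongAdd v J).smul_mem c (hs g)

theorem isIntegral_quotient {v : Fin n → ℂ} {ζ : MvPolynomial (Fin n) ℂ} (hζ : dirDeriv v ζ = 1)
    {J : Ideal (MvPolynomial (Fin n) ℂ)} {G : Polynomial (constAlong v)} (hG : G.Monic)
    (hGJ : Polynomial.aeval ζ G ∈ J) :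
    (algebraMap (constAlong v) (MvPolynomial (Fin n) ℂ ⧸ J)).IsIntegral := by
  have h0 (P : Polynomial (constAlong v)) :
      Polynomial.aeval (Ideal.Quotient.mk J ζ) P = Ideal.Quotient.mk J (Polynomial.aeval ζ P) :=
    Polynomial.aeval_algHom_apply (Ideal.Quotient.mkₐ (constAlong v) J) ζ P
  have hζint : IsIntegral (constAlong v) (Ideal.Quotient.mk J ζ) :=
    ⟨G, hG, by rw [← Polynomial.aeval_def, h0, Ideal.Quotient.eq_zero_iff_mem]; exact hGJ⟩
  intro b
  obtain ⟨f, rfl⟩ := Ideal.Quotient.mk_surjective b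
  change IsIntegral (constAlong v) (Ideal.Quotient.mk J f)
  rw [← aeval_expand hζ f, ← h0, Polynomial.aeval_eq_sum_range]
  exact IsIntegral.sum _ fun i _ => (hζint.pow i).smul _

/-- Every polynomial is a polynomial in ζ over `constAlong v`, so the quotient by the extended ideal
is an image of a polynomial ring in one variable over the quotient by c. -/
theorem ringKrullDim_quotient_map_constAlong_le {v : Fin n → ℂ} {ζ : MvPolynomial (Fin n) ℂ}
    (hζ : dirDeriv v ζ = 1) [IsNoetherianRing (constAlong v)] (c : Ideal (constAlong v)) :
    ringKrullDim (MvPolynomial (Fin n) ℂ ⧸ c.map (algebraMap _ (MvPolynomial (Fin n) ℂ))) ≤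
      ringKrullDim (constAlong v ⧸ c) + 1 := by
  refine le_trans ?_ (Polynomial.ringKrullDim_of_isNoetherianRing (R := constAlong v ⧸ c)).le
  set ce := c.map (algebraMap (constAlong v) (MvPolynomial (Fin n) ℂ)) with hce
  set ψ : constAlong v ⧸ c →+* MvPolynomial (Fin n) ℂ ⧸ ce :=
    Ideal.quotientMap ce (algebraMap _ _) Ideal.le_comap_map with hψ
  refine ringKrullDim_le_of_surjective
    (Polynomial.eval₂RingHom ψ (Ideal.Quotient.mk ce ζ)) fun b => ?_
  obtain ⟨f, rfl⟩ := Ideal.Quotient.mk_surjective b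
  refine ⟨(expand hζ f).map (Ideal.Quotient.mk c), ?_⟩
  rw [Polynomial.coe_eval₂RingHom, Polynomial.eval₂_map]
  nth_rewrite 2 [← aeval_expand hζ f]
  rw [Polynomial.aeval_def, Polynomial.hom_eval₂]
  rfl

/-- Near a given point `x`, an algebraic set of codimension at least two all of whose tangent
spaces are proper is, in generic directions `v` and `u`, the graph of a rational function
of `ζ`, with a denominator that is constant along both `v` and `u`. -/
theorem exists_graph_of_generic (hn : 2 ≤ n) {J : Ideal (MvPolynomial (Fin n) ℂ)}
    (hrad : J.IsRadical) (hJ : ringKrullDim (MvPolynomial (Fin n) ℂ ⧸ J) + 2 ≤ n)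
    (hreg : ∀ p ∈ zeroLocus ℂ J, ∃ f ∈ J, ∃ v, eval p (dirDeriv v f) ≠ 0)
    {x : Fin n → ℂ} (hx : x ∈ zeroLocus ℂ J) :
    ∃ ρ : MvPolynomial (Fin n) ℂ, ρ ≠ 0 ∧ ∀ v, eval v ρ ≠ 0 →
      ∃ (u : Fin n → ℂ) (ζ η s r : MvPolynomial (Fin n) ℂ) (G : Polynomial (constAlong v)),
        dirDeriv v ζ = 1 ∧ dirDeriv u ζ = 0 ∧ dirDeriv u η = 1 ∧ dirDeriv v η = 0 ∧
        dirDeriv u s = 0 ∧ dirDeriv v s = 0 ∧ dirDeriv v r = 0 ∧ eval x s ≠ 0 ∧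
        s * ζ - r ∈ J ∧ G.Monic ∧ Polynomial.aeval ζ G ∈ J := by
  classical
  have hfin : (J.minimalPrimes).Finite := Ideal.finite_minimalPrimes_of_isNoetherianRing _ J
  have hpt (P : Ideal (MvPolynomial (Fin n) ℂ)) (hP : P ∈ J.minimalPrimes) :
      ∃ p, p ∈ zeroLocus ℂ P := by
    have hprime : P.IsPrime := hP.1.1
    by_contra! hcon
    have h1 := MvPolynomial.vanishingIdeal_zeroLocus_eq_radical (K := ℂ) P
    rw [Set.eq_empty_of_forall_notMem hcon, vanishingIdeal_empty, hprime.radical] at h1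
    exact hprime.ne_top h1.symm
  choose! pt hpt using hpt
  have hloc (P : Ideal (MvPolynomial (Fin n) ℂ)) (hP : P ∈ J.minimalPrimes) :=
    exists_mul_mem_constAlongAdd_of_generic hJ
      (hreg (pt P) (zeroLocus_anti_mono hP.1.2 (hpt P hP)))
  choose! ρP hρP0 hρP using hloc
  obtain ⟨ρx, hρx0, hρx⟩ := exists_mul_mem_constAlongAdd_of_generic hJ (hreg x hx)
  obtain ⟨ρm, hρm0, hρm⟩ := exists_monic_of_generic (ne_bot_of_codim hJ)
  -- The projection must be an embedding near x and near one chosen point on each component.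
  refine ⟨ρx * ρm * X ⟨0, by omega⟩ * ∏ P ∈ hfin.toFinset, ρP P, mul_ne_zero (mul_ne_zero
    (mul_ne_zero hρx0 hρm0) (X_ne_zero _)) (Finset.prod_ne_zero_iff.mpr fun P hP =>
      hρP0 P (hfin.mem_toFinset.mp hP)), fun v hv => ?_⟩
  simp only [map_mul, mul_ne_zero_iff, eval_X, map_prod, Finset.prod_ne_zero_iff,
    Set.Finite.mem_toFinset] at hv
  obtain ⟨⟨⟨hvx, hvm⟩, hv0⟩, hvP⟩ := hv
  have hvne : v ≠ 0 := fun h => hv0 (by simp [h])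
  have : NeZero v := ⟨hvne⟩
  set c := conductor v J with hc
  obtain ⟨ζ₀, hζ₀, -⟩ := exists_coordinate hvne x
  obtain ⟨G₀, hG₀, hGJ₀⟩ := hρm v ζ₀ hvm hζ₀
  have hred : IsReduced (MvPolynomial (Fin n) ℂ ⧸ J) :=
    (Ideal.isRadical_iff_quotient_reduced J).mp hrad
  -- On every component the conductor has an element nonzero at the chosen point, hence outside the
  -- corresponding minimal prime.
  have hdim1 : ringKrullDim (constAlong v ⧸ c) + 1 ≤ ringKrullDim (MvPolynomial (Fin n) ℂ ⧸ J) := by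
    refine ringKrullDim_quotient_succ_le (algebraMap (constAlong v) (MvPolynomial (Fin n) ℂ ⧸ J))
      (isIntegral_quotient hζ₀ hG₀ hGJ₀) c (fun a ha g => ?_) fun P hP => ?_
    · have ha' : (a : MvPolynomial (Fin n) ℂ) ∈ J := Ideal.Quotient.eq_zero_iff_mem.mp ha
      exact mem_constAlongAdd.mpr ⟨0, map_zero _, by simpa using J.mul_mem_right g ha'⟩
    · have hPJ : P.comap (Ideal.Quotient.mk J) ∈ J.minimalPrimes := by
        rw [Ideal.minimalPrimes_eq_comap]; exact ⟨P, hP, rfl⟩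
      obtain ⟨s, hs, hsp, hsg⟩ := hρP _ hPJ v (hvP _ hPJ)
      refine ⟨⟨s, hs⟩, hsg, fun hmem => hsp ?_⟩
      have := hpt _ hPJ s hmem
      rwa [MvPolynomial.aeval_eq_eval] at this
  set ce := c.map (algebraMap (constAlong v) (MvPolynomial (Fin n) ℂ)) with hce
  -- The cylinder over the conductor locus regains the lost dimension, so it again has codimension
  -- at least two and can be projected along a second direction u.
  have hdim : ringKrullDim (MvPolynomial (Fin n) ℂ ⧸ ce) + 2 ≤ n :=
    (add_le_add_left ((ringKrullDim_quotient_map_constAlong_le hζ₀ c).trans hdim1) 2).trans hJ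
  have hxce : x ∉ zeroLocus ℂ ce := by
    intro hmem
    obtain ⟨s, hs, hsx, hsg⟩ := hρx v hvx
    have h1 : s ∈ ce := Ideal.mem_map_of_mem (algebraMap (constAlong v) (MvPolynomial (Fin n) ℂ))
      (show (⟨s, hs⟩ : constAlong v) ∈ c from hsg)
    have := hmem s h1
    rw [MvPolynomial.aeval_eq_eval] at this
    exact hsx this
  obtain ⟨ρu, hρu0, hρu⟩ := exists_mem_constAlong_of_generic hn hdim hxce
  obtain ⟨δ, hδ0, hδ⟩ := exists_dual_coordinates hn hvne x
  obtain ⟨u, hu⟩ := exists_eval_ne_zero (mul_ne_zero hρu0 hδ0)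
  rw [map_mul, mul_ne_zero_iff] at hu
  obtain ⟨-, S, hS, hSu, hSx⟩ := hρu u hu.1
  obtain ⟨ζ, η, hζv, hζu, hηu, hηv, hζx⟩ := hδ u hu.2
  obtain ⟨G, hG, hGJ⟩ := hρm v ζ hvm hζv
  have hproj : ce ≤ c.comap (projAlong hζv).toRingHom := by
    refine Ideal.map_le_iff_le_comap.mpr fun a ha => ?_
    rw [Ideal.mem_comap, Ideal.mem_comap]
    exact (projAlong_coe hζv a).symm ▸ ha
  -- Projecting S along v makes it constant along both directions and keeps it in the conductor; its
  -- value at x is unchanged because ζ(x) = 0.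
  have hsc : projAlong hζv S ∈ c := hproj hS
  obtain ⟨r, hr, hrJ⟩ := mem_constAlongAdd.mp (hsc ζ)
  refine ⟨u, ζ, η, projAlong hζv S, r, G, hζv, hζu, hηu, hηv, ?_, (projAlong hζv S).2, hr, ?_,
    hrJ, hG, hGJ⟩
  · rw [dirDeriv_projAlong hζv hζu, hSu, map_zero]; rfl
  · rw [eval_projAlong, hζx]
    simpa using hSx

/-! ### Multiplier ideals at points off and on the algebraic set. -/

theorem submodule_eq_top_of_generic (E : Submodule ℂ (Fin n → ℂ)) {ρ : MvPolynomial (Fin n) ℂ}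
    (hρ : ρ ≠ 0) (hE : ∀ v, eval v ρ ≠ 0 → v ∈ E) : E = ⊤ := by
  obtain ⟨w, hw⟩ := exists_eval_ne_zero hρ
  refine eq_top_iff.mpr fun e _ => ?_
  -- The extra factor forces t ≠ 0, so e is a multiple of the difference of the generic vectors w +
  -- te and w.
  have hP : lineEval w e ρ * Polynomial.X ≠ 0 := by
    refine mul_ne_zero (fun h => hw ?_) Polynomial.X_ne_zero
    have := eval_lineEval w e 0 ρ
    rw [h] at this
    simpa using this.symm
  obtain ⟨t, ht⟩ : ∃ t, (lineEval w e ρ * Polynomial.X).eval t ≠ 0 := by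
    by_contra! h
    exact hP (Polynomial.funext fun t => by simpa using h t)
  rw [Polynomial.eval_mul, mul_ne_zero_iff, eval_lineEval, Polynomial.eval_X] at ht
  have h1 := E.smul_mem t⁻¹ (E.sub_mem (hE _ ht.1) (hE _ hw))
  rwa [add_sub_cancel_left, inv_smul_smul₀ ht.2] at h1

/-- The polynomials `q` such that `lieAlg Y` contains all products of `q` with a vector field
whose coordinate functions lie in `K`. -/
def multiplierIdeal (Y : Set (Fin n → ℂ)) (K : Ideal (MvPolynomial (Fin n) ℂ)) :
    Ideal (MvPolynomial (Fin n) ℂ) where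
  carrier := {q | ∀ h ∈ K, ∀ V : VF n, (q * h) • V ∈ lieAlg Y}
  add_mem' := fun {a b} ha hb h hh V => by
    rw [add_mul, add_smul]; exact (lieAlg Y).add_mem (ha h hh V) (hb h hh V)
  zero_mem' := fun h hh V => by simp
  smul_mem' := fun c q hq h hh V => by
    rw [smul_eq_mul, mul_comm c, mul_assoc]; exact hq _ (K.mul_mem_left c hh) V

theorem VF.eq_sum_smul_dirDeriv (V : VF n) : V = ∑ i, V (X i) • dirDeriv (Pi.single i 1) := by
  refine MvPolynomial.derivation_ext fun j => ?_
  rw [← Derivation.coeFnAddMonoidHom_apply, ← Derivation.coeFnAddMonoidHom_apply, map_sum,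
    Finset.sum_apply]
  simp only [Derivation.coeFnAddMonoidHom_apply, Derivation.smul_apply, dirDeriv_X, smul_eq_mul]
  rw [Finset.sum_eq_single j (fun i _ hij => by simp [hij.symm]) (by simp)]
  simp

/-- Directions admitting a suitable q form a subspace, since the q's can be multiplied. Being
generic they include the standard basis, and the product of the basis multipliers serves all fields.
-/
theorem exists_mem_multiplierIdeal {Y : Set (Fin n → ℂ)} {K : Ideal (MvPolynomial (Fin n) ℂ)}
    {w : Fin n → ℂ} (hgen : ∃ ρ : MvPolynomial (Fin n) ℂ, ρ ≠ 0 ∧ ∀ v, eval v ρ ≠ 0 →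
      ∃ q, eval w q ≠ 0 ∧ ∀ h ∈ K, (q * h) • dirDeriv v ∈ lieAlg Y) :
    ∃ q ∈ multiplierIdeal Y K, eval w q ≠ 0 := by
  obtain ⟨ρ, hρ, hgen⟩ := hgen
  let E : Submodule ℂ (Fin n → ℂ) :=
    { carrier := {v | ∃ q, eval w q ≠ 0 ∧ ∀ h ∈ K, (q * h) • dirDeriv v ∈ lieAlg Y}
      add_mem' := by
        rintro a b ⟨p, hp, hpa⟩ ⟨q, hq, hqb⟩
        refine ⟨p * q, by rw [map_mul]; exact mul_ne_zero hp hq, fun h hh => ?_⟩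
        rw [dirDeriv_add, smul_add]
        refine (lieAlg Y).add_mem ?_ ?_
        · rw [mul_assoc]; exact hpa _ (K.mul_mem_left q hh)
        · rw [mul_comm p, mul_assoc]; exact hqb _ (K.mul_mem_left p hh)
      zero_mem' := ⟨1, by simp, fun h _ => by simp [dirDeriv_zero]⟩
      smul_mem' := by
        rintro c a ⟨p, hp, hpa⟩
        refine ⟨p, hp, fun h hh => ?_⟩
        rw [dirDeriv_smul, smul_comm]
        exact (lieAlg Y).smul_mem c (hpa h hh) }
  have hE : E = ⊤ := submodule_eq_top_of_generic E hρ hgen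
  have hmem (i : Fin n) : (Pi.single i 1 : Fin n → ℂ) ∈ E := hE ▸ Submodule.mem_top
  choose q hq hqL using hmem
  refine ⟨∏ i, q i, fun h hh V => ?_, by
    rw [map_prod]; exact Finset.prod_ne_zero_iff.mpr fun i _ => hq i⟩
  rw [V.eq_sum_smul_dirDeriv, Finset.smul_sum]
  refine sum_mem fun i _ => ?_
  rw [smul_smul, ← Finset.mul_prod_erase Finset.univ q (Finset.mem_univ i), mul_assoc, mul_assoc]
  exact hqL i _ (K.mul_mem_left _ (K.mul_mem_right _ hh))

theorem exists_mem_multiplierIdeal_top (hn : 2 ≤ n) {Y : Set (Fin n → ℂ)}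
    (hcodim : ringKrullDim (MvPolynomial (Fin n) ℂ ⧸ definingIdeal Y) + 2 ≤ n)
    {w : Fin n → ℂ} (hw : w ∉ zeroLocus ℂ (definingIdeal Y)) :
    ∃ q ∈ multiplierIdeal Y ⊤, eval w q ≠ 0 := by
  obtain ⟨ρ, hρ, hgen⟩ := exists_mem_constAlong_of_generic hn hcodim hw
  refine exists_mem_multiplierIdeal ⟨ρ, hρ, fun v hv => ?_⟩
  obtain ⟨hv0, g, hg, hgv, hgw⟩ := hgen v hv
  obtain ⟨δ, hδ0, hδ⟩ := exists_dual_coordinates hn hv0 w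
  obtain ⟨u, hu⟩ := exists_eval_ne_zero (mul_ne_zero hρ hδ0)
  rw [map_mul, mul_ne_zero_iff] at hu
  obtain ⟨-, p, hp, hpu, hpw⟩ := hgen u hu.1
  obtain ⟨ζ, η, hζv, hζu, hηu, hηv, -⟩ := hδ u hu.2
  refine ⟨p * g, by rw [map_mul]; exact mul_ne_zero hpw hgw, fun h _ => ?_⟩
  rw [← aeval_expand hζv h, Polynomial.aeval_eq_sum_range, Finset.mul_sum, Finset.sum_smul]
  refine sum_mem fun i _ => ?_
  -- Each term splits into p ζ^i, constant along u, and g a, constant along v.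
  rw [Subalgebra.smul_def, smul_eq_mul, show ∀ a : MvPolynomial (Fin n) ℂ,
    p * g * (a * ζ ^ i) = (p * ζ ^ i) * (g * a) from fun a => by ring]
  refine mul_smul_dirDeriv_mem_lieAlg hηu hηv (Ideal.mul_mem_right _ _ hp) ?_
    (Ideal.mul_mem_right _ _ hg) ?_
  · simp [hpu, hζu, Derivation.leibniz_pow]
  · simp [hgv, mem_constAlong.mp ((expand hζv h).coeff i).2]

/-- Modulo J the degree in ζ is at most that of G, so this power of s suffices to replace each sζ by
(sζ - r) + r. -/
theorem pow_mul_sub_aeval_mem {v : Fin n → ℂ} {ζ s r : MvPolynomial (Fin n) ℂ}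
    (hζ : dirDeriv v ζ = 1) (hs : dirDeriv v s = 0) (hr : dirDeriv v r = 0)
    {J : Ideal (MvPolynomial (Fin n) ℂ)} {G : Polynomial (constAlong v)} (hG : G.Monic)
    (hGJ : Polynomial.aeval ζ G ∈ J) (f : MvPolynomial (Fin n) ℂ) :
    ∃ P : Polynomial (constAlong v),
      s ^ G.natDegree * f - Polynomial.aeval (s * ζ - r) P ∈ J := by
  obtain ⟨a, ha⟩ := exists_sum_sub_mem hζ hG hGJ f
  let s' : constAlong v := ⟨s, hs⟩
  let r' : constAlong v := ⟨r, hr⟩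
  refine ⟨∑ i ∈ Finset.range (G.natDegree + 1),
    Polynomial.C (a i * s' ^ (G.natDegree - i)) * (Polynomial.X + Polynomial.C r') ^ i, ?_⟩
  convert J.mul_mem_left (s ^ G.natDegree) ha using 1
  rw [mul_sub, map_sum, Finset.mul_sum]
  congr 1
  refine Finset.sum_congr rfl fun i hi => ?_
  have hi' : i ≤ G.natDegree := by simpa [Nat.lt_succ_iff] using hi
  simp only [map_mul, map_pow, map_add, Polynomial.aeval_C, Polynomial.aeval_X,
    Subalgebra.algebraMap_def, Subalgebra.smul_def, smul_eq_mul, s', r']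
  simp only [Algebra.algebraMap_self, RingHom.id_apply, sub_add_cancel]
  rw [← Nat.sub_add_cancel hi', pow_add, Nat.sub_add_cancel hi', mul_pow]
  ring

theorem exists_mem_multiplierIdeal_definingIdeal (hn : 2 ≤ n) {Y : Set (Fin n → ℂ)}
    (hrad : (definingIdeal Y).IsRadical)
    (hcodim : ringKrullDim (MvPolynomial (Fin n) ℂ ⧸ definingIdeal Y) + 2 ≤ n)
    (hreg : ∀ p ∈ zeroLocus ℂ (definingIdeal Y),
      ∃ f ∈ definingIdeal Y, ∃ v, eval p (dirDeriv v f) ≠ 0) {N : ℕ}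
    (hN : definingIdeal Y ^ N ≤ multiplierIdeal Y ⊤)
    {x : Fin n → ℂ} (hx : x ∈ zeroLocus ℂ (definingIdeal Y)) :
    ∃ q ∈ multiplierIdeal Y (definingIdeal Y), eval x q ≠ 0 := by
  obtain ⟨ρ, hρ, hgen⟩ := exists_graph_of_generic hn hrad hcodim hreg hx
  refine exists_mem_multiplierIdeal ⟨ρ, hρ, fun v hv => ?_⟩
  obtain ⟨u, ζ, η, s, r, G, hζv, hζu, hηu, hηv, hsu, hsv, hrv, hsx, hF, hG, hGI⟩ := hgen v hv
  set F := s * ζ - r with hFdef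
  have hFv : dirDeriv v F = s := by simp [hFdef, hζv, hsv, hrv]
  refine ⟨s * s ^ (G ^ (N + 1)).natDegree, by
    rw [map_mul, map_pow]; exact mul_ne_zero hsx (pow_ne_zero _ hsx), fun h hh => ?_⟩
  -- The exponent N + 1 puts the error both in I^N, where `hN` applies, and in I, even if N = 0.
  obtain ⟨P, hP⟩ := pow_mul_sub_aeval_mem hζv hsv hrv (J := definingIdeal Y ^ (N + 1))
    (hG.pow (N + 1)) (by rw [map_pow]; exact Ideal.pow_mem_pow hGI _) h
  set k := (G ^ (N + 1)).natDegree
  rw [← hFdef] at hP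
  have hPI : s ^ k * h - Polynomial.aeval F P ∈ definingIdeal Y := Ideal.pow_le_self (by lia) hP
  have hPL : (s * (s ^ k * h - Polynomial.aeval F P)) • dirDeriv v ∈ lieAlg Y := by
    have := hN (Ideal.pow_le_pow_right (Nat.le_succ N) hP) s Submodule.mem_top (dirDeriv v)
    rwa [mul_comm] at this
  have hcv (i : ℕ) : dirDeriv v (P.coeff i : MvPolynomial (Fin n) ℂ) = 0 := (P.coeff i).2
  have hc0 : (P.coeff 0 : MvPolynomial (Fin n) ℂ) ∈ definingIdeal Y := by
    -- As h, the error and F all lie in I, so does the constant coefficient of P.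
    have h1 : Polynomial.aeval F P ∈ definingIdeal Y := by
      have := (definingIdeal Y).sub_mem (Ideal.mul_mem_left _ (s ^ k) hh) hPI
      rwa [sub_sub_cancel] at this
    rw [← Polynomial.divX_mul_X_add P, map_add, map_mul, Polynomial.aeval_X,
      Polynomial.aeval_C] at h1
    exact ((definingIdeal Y).add_mem_iff_right (Ideal.mul_mem_left _ _ hF)).mp h1
  have hmain : (s * Polynomial.aeval F P) • dirDeriv v ∈ lieAlg Y := by
    rw [Polynomial.aeval_eq_sum_range, Finset.mul_sum, Finset.sum_smul]
    refine sum_mem fun i _ => ?_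
    rw [Subalgebra.smul_def, smul_eq_mul]
    match i with
    | 0 =>
      refine smul_dirDeriv_mem_lieAlg ?_ (by simp [hsv, hcv])
      rw [pow_zero, mul_one]
      exact Ideal.mul_mem_left _ _ hc0
    | 1 =>
      refine smul_dirDeriv_mem_lieAlg ?_ (by simp [hsv, hcv, hFv])
      rw [pow_one]
      exact Ideal.mul_mem_left _ _ (Ideal.mul_mem_left _ _ hF)
    -- One factor F joins the coefficient to form an element of I affine along v; the remaining
    -- power F^(i+1) multiplies the triangular field.
    | i + 2 =>
      have := pow_mul_smul_dirDeriv_mem_lieAlg hsu hsv hrv hζu hζv hηu hηv hF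
        (Nat.succ_ne_zero i) (Ideal.mul_mem_left _ (P.coeff (i + 2) : MvPolynomial (Fin n) ℂ) hF)
        (by simp [hcv, hFv, hsv])
      convert this using 3
      rw [← hFdef, Nat.succ_eq_add_one]
      ring
  have := (lieAlg Y).add_mem hPL hmain
  rwa [← add_smul, ← mul_add, sub_add_cancel, ← mul_assoc] at this

/-! ### From local multipliers to the global statement. -/

theorem isRadical_definingIdeal (Y : Set (Fin n → ℂ)) : (definingIdeal Y).IsRadical := by
  rintro f ⟨k, hk⟩ p hp
  have := hk p hp
  rw [map_pow] at this
  exact eq_zero_of_pow_eq_zero this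

theorem IsClosedAlgebraic.zeroLocus_definingIdeal {Y : Set (Fin n → ℂ)}
    (hY : IsClosedAlgebraic Y) : zeroLocus ℂ (definingIdeal Y) = Y := by
  obtain ⟨J, rfl⟩ := hY
  exact (zeroLocus_anti_mono (le_vanishingIdeal_zeroLocus J)).antisymm
    (zeroLocus_vanishingIdeal_le _)

theorem differential_apply (f : MvPolynomial (Fin n) ℂ) (z v : Fin n → ℂ) :
    differential f z v = eval z (dirDeriv v f) := by
  rw [dirDeriv_eq_sum, map_sum, differential, LinearMap.sum_apply]
  simp [mul_comm]

theorem exists_dirDeriv_ne_zero (hn : 2 ≤ n) {Y : Set (Fin n → ℂ)} {x : Fin n → ℂ}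
    (htan : Module.finrank ℂ (zariskiTangentSpace Y x) ≤ n - 1) :
    ∃ f ∈ definingIdeal Y, ∃ v, eval x (dirDeriv v f) ≠ 0 := by
  by_contra! hcon
  have htop : zariskiTangentSpace Y x = ⊤ := by
    rw [zariskiTangentSpace, iInf₂_eq_top]
    refine fun f hf => LinearMap.ker_eq_top.mpr (LinearMap.ext fun v => ?_)
    rw [differential_apply]
    exact hcon f hf v
  rw [htop, finrank_top, Module.finrank_fin_fun] at htan
  omega

theorem lieAlg_le_AVF (Y : Set (Fin n → ℂ)) : lieAlg Y ≤ AVF (definingIdeal Y) := by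
  refine LieSubalgebra.lieSpan_le.mpr ?_
  rintro V ⟨-, hV⟩ i z hz
  rw [MvPolynomial.aeval_eq_eval]
  exact congrFun (hV z hz) i

/-- The Nullstellensatz is used twice: multipliers for the unit ideal vanish only on the zero set of
I, so contain some I^N; with this N, the multipliers for I have no common zero. -/
theorem multiplierIdeal_definingIdeal_eq_top (hn : 2 ≤ n) {Y : Set (Fin n → ℂ)}
    (hcodim : ringKrullDim (MvPolynomial (Fin n) ℂ ⧸ definingIdeal Y) + 2 ≤ n)
    (hreg : ∀ p ∈ zeroLocus ℂ (definingIdeal Y),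
      ∃ f ∈ definingIdeal Y, ∃ v, eval p (dirDeriv v f) ≠ 0) :
    multiplierIdeal Y (definingIdeal Y) = ⊤ := by
  have hle : zeroLocus ℂ (multiplierIdeal Y ⊤) ⊆ zeroLocus ℂ (definingIdeal Y) := by
    intro w hw
    by_contra hcon
    obtain ⟨q, hq, hqw⟩ := exists_mem_multiplierIdeal_top hn hcodim hcon
    have := hw q hq
    rw [MvPolynomial.aeval_eq_eval] at this
    exact hqw this
  have hrad : definingIdeal Y ≤ (multiplierIdeal Y ⊤).radical := by
    rw [← vanishingIdeal_zeroLocus_eq_radical (K := ℂ)]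
    exact (le_vanishingIdeal_zeroLocus (K := ℂ) _).trans (vanishingIdeal_anti_mono hle)
  obtain ⟨N, hN⟩ := Ideal.exists_pow_le_of_le_radical_of_fg hrad
    ((isNoetherianRing_iff_ideal_fg _).mp inferInstance _)
  have hempty : zeroLocus ℂ (multiplierIdeal Y (definingIdeal Y)) = ∅ := by
    refine Set.eq_empty_of_forall_notMem fun x hx => ?_
    obtain ⟨q, hq, hqx⟩ : ∃ q ∈ multiplierIdeal Y (definingIdeal Y), eval x q ≠ 0 := by
      by_cases hxY : x ∈ zeroLocus ℂ (definingIdeal Y)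
      · exact exists_mem_multiplierIdeal_definingIdeal hn (isRadical_definingIdeal Y) hcodim hreg
          hN hxY
      · obtain ⟨q, hq, hqx⟩ := exists_mem_multiplierIdeal_top hn hcodim hxY
        exact ⟨q, fun h _ V => hq h Submodule.mem_top V, hqx⟩
    have := hx q hq
    rw [MvPolynomial.aeval_eq_eval] at this
    exact hqx this
  have h1 := vanishingIdeal_zeroLocus_eq_radical (K := ℂ) (multiplierIdeal Y (definingIdeal Y))
  rw [hempty, vanishingIdeal_empty] at h1
  exact Ideal.radical_eq_top.mp h1.symm

end AlgebraicDensity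

end

theorem theorem4p7 (n : ℕ) (hn : 2 ≤ n) (X : Set (Fin n → ℂ))
    (hX : AlgebraicDensity.IsClosedAlgebraic X)
    (hcodim : AlgebraicDensity.algDim X + 2 ≤ (n : WithBot ℕ∞))
    (htan : ∀ x ∈ X, Module.finrank ℂ (AlgebraicDensity.zariskiTangentSpace X x) ≤ n - 1) :
    AlgebraicDensity.lieAlg X =
      AlgebraicDensity.AVF (AlgebraicDensity.definingIdeal X) := by
  refine (AlgebraicDensity.lieAlg_le_AVF X).antisymm fun V hV => ?_
  have htop := AlgebraicDensity.multiplierIdeal_definingIdeal_eq_top hn hcodim fun p hp =>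
    AlgebraicDensity.exists_dirDeriv_ne_zero hn (htan p (hX.zeroLocus_definingIdeal ▸ hp))
  have h1 : (1 : MvPolynomial (Fin n) ℂ) ∈ AlgebraicDensity.multiplierIdeal X
      (AlgebraicDensity.definingIdeal X) := htop ▸ Submodule.mem_top
  rw [V.eq_sum_smul_dirDeriv]
  refine sum_mem fun i _ => ?_
  have := h1 _ (hV i) (AlgebraicDensity.dirDeriv (Pi.single i 1))
  rwa [one_mul] at this
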